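/- **The resource.** $\mathsf{RSP}_V$ has a left (client) and a right (server) interface. It takes an input $W\in\{X,Z\}$ on the left and a bit $c$ on the right. If $c=1$ it outputs $\mathsf{ERR}$ on both interfaces. If $c=0$ and $W=Z$, it picks a uniform bit $b$, outputs $b$ on the left and the state $|b\rangle\langle b|$ on the right. If $c=0$ and $W=X$, it picks a uniform angle $\theta\in\{0,\tfrac{\pi}{4},\dots,\tfrac{7\pi}{4}\}$, outputs $\theta$ on the left and $|+_\theta\rangle\langle +_\theta|$ on the right, where $|+_\theta\rangle=\frac1{\sqrt2}(|0\rangle+e^{i\theta}|1\rangle)$. The filter $\vdash$ fixes $c=0$ on the right interface. **Classical realizability.** A protocol $(\pi_A,\pi_B)$ over the classical channel $\mathcal C$ consists of two quantum parties, given by finite sequences of quantum instruments on finite registers of qubits, which exchange finitely many rounds of classical messages: $\pi_A$ receives the left input and finally gives a left output, and $\pi_B$ finally gives a right output. A resource $\mathcal S$ is $\varepsilon$-classically-realizable if there are such a protocol and a simulator $\sigma$ (a quantum party that talks to the right interface of $\mathcal S$, at a moment and with a bit $c$ of its choice, and plays the server side of $\mathcal C$) such that $$\pi_A\,\mathcal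 C\,\pi_B\approx_\varepsilon \mathcal S\vdash \qquad\text{and}\qquad \pi_A\,\mathcal C\approx_\varepsilon \mathcal S\,\sigma .$$ Here $\approx_\varepsilon$ means that no distinguisher interacting with both interfaces has advantage $|\Pr[D=1\text{ on the first system}]-\Pr[D=1\text{ on the second system}]|$ greater than $\varepsilon$. It suffices to consider distinguishers that supply the left input first and use the left output at the end. In the computational version there is a security parameter $n$ and $\varepsilon:\mathbb N\to[0,\infty)$. Protocols, simulators and distinguishers are families indexed by $n$; $\pi_B$ and the distinguishers are given by (non-uniform) quantum circuits of size polynomial in $n$, with gates acting on at most three qubits, while $\pi_A$ and $\sigma$ are unrestricted; and $\approx_\varepsilon$ means that each polynomial-size family of distinguishers has advantage at most $\varepsilon(n)$ for all sufficiently large $n$. **Statement.** There is a universal constant $\eta>0$ such that 1. for all $0\le\varepsilon<\eta$, $\mathsf{RSP}_V$ is not $\varepsilon$-classically-realizable (with unbounded parties and distinguishers); 2. for all $\varepsilon:\mathbb N\to[0,\infty)$ with $\varepsilon(n)<\eta$ for infinitely many $n$ (in particular for every constant $0\le\varepsilon<\eta$ and every negligible $\varepsilon$), $\mathsf{RSP}_V$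 is not $\varepsilon$-classically-realizable in the computational sense, i.e. against polynomially bounded quantum distinguishers. -/

import Mathlib

open Matrix Filter
open scoped ComplexOrder

noncomputable section

namespace RemoteState

/-! ## Qubit registers, completely positive maps and quantum instruments -/

/-- Computational basis labels of a register of `m` qubits. -/
abbrev Reg (m : ℕ) : Type := Fin m → Bool

/-- Operators (in particular density matrices) on a register of `m` qubits. -/
abbrev Op (m : ℕ) : Type := Matrix (Reg m) (Reg m) ℂ

/-- The tensor product `A ⊗ B` of operators on `a` and `b` qubits, as an operator on `a + b`
qubits (the first `a` qubits are those of `A`). -/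
def join {a b : ℕ} (A : Op a) (B : Op b) : Op (a + b) :=
  Matrix.of fun z z' =>
    A (fun i => z (Fin.castAdd b i)) (fun i => z' (Fin.castAdd b i)) *
      B (fun i => z (Fin.natAdd a i)) (fun i => z' (Fin.natAdd a i))

/-- `Φ ⊗ id` on the tensor product with a `k`-dimensional system. -/
def ampliate {m m' : ℕ} (Φ : Op m →ₗ[ℂ] Op m') (k : ℕ)
    (M : Matrix (Reg m × Fin k) (Reg m × Fin k) ℂ) :
    Matrix (Reg m' × Fin k) (Reg m' × Fin k) ℂ :=
  Matrix.of fun p p' => Φ (Matrix.of fun i j => M (i, p.2) (j, p'.2)) p.1 p'.1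

/-- Complete positivity: `Φ ⊗ id_k` preserves positive semidefiniteness for all `k`. -/
def IsCP {m m' : ℕ} (Φ : Op m →ₗ[ℂ] Op m') : Prop :=
  ∀ (k : ℕ) (M : Matrix (Reg m × Fin k) (Reg m × Fin k) ℂ),
    M.PosSemidef → (ampliate Φ k M).PosSemidef

/-- A quantum instrument with classical input `x : α` and classical outcome `y : β`. On input `x`
it acts on `m x` qubits; when the outcome is `y` it leaves `m' y` qubits. The matrix `map x y ρ` is
the unnormalised post-measurement state: its trace is the probability of `y`. -/
structure Instrument (α β : Type) [Fintype β] (m : α → ℕ) (m' : β → ℕ) where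
  map : (x : α) → (y : β) → Op (m x) →ₗ[ℂ] Op (m' y)
  cp : ∀ x y, IsCP (map x y)
  tp : ∀ x (ρ : Op (m x)), ∑ y, (map x y ρ).trace = ρ.trace

/-! ## Quantum circuits and their size -/

/-- A gate: an arbitrary unitary on at most three of the `w` wires. -/
structure Gate (w : ℕ) where
  arity : ℕ
  arity_le : arity ≤ 3
  wires : Fin arity ↪ Fin w
  U : Matrix.unitaryGroup (Reg arity) ℂ

open Classical in
/-- The operator of a gate on all `w` wires (identity on the wires it does not touch). -/
def Gate.toOp {w : ℕ} (g : Gate w) : Op w :=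
  Matrix.of fun z' z =>
    if ∀ j, j ∉ Set.range g.wires → z' j = z j then
      (g.U : Op g.arity) (fun i => z' (g.wires i)) (fun i => z (g.wires i))
    else 0

/-- A circuit for an instrument with classical inputs in `α`, given on the wires `A` through the
binary encoding `encIn`, and outcomes in `β`, read from the wires `B` through `encOut`. All wires
other than the input ones start in `|0⟩`. After the gates the wires `msgOut` are measured in the
computational basis, the wires `memOut y` are kept and the others are discarded. -/
structure Circuit {α β A B : Type} (encIn : α → A → Bool) (encOut : β → B → Bool)
    (m : α → ℕ) (m' : β → ℕ) where
  width : ℕ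
  msgIn : A ↪ Fin width
  memIn : (x : α) → Fin (m x) ↪ Fin width
  disjoint_in : ∀ x i a, memIn x i ≠ msgIn a
  gates : List (Gate width)
  msgOut : B ↪ Fin width
  memOut : (y : β) → Fin (m' y) ↪ Fin width
  disjoint_out : ∀ y i b, memOut y i ≠ msgOut b

namespace Circuit

variable {α β A B : Type} {encIn : α → A → Bool} {encOut : β → B → Bool}
  {m : α → ℕ} {m' : β → ℕ}

open Classical in
/-- The isometry that loads the memory and the classical input `x` and sets the rest to `|0⟩`. -/
def load (C : Circuit encIn encOut m m') (x : α) : Matrix (Reg C.width) (Reg (m x)) ℂ :=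
  Matrix.of fun z b =>
    if (∀ i, z (C.memIn x i) = b i) ∧ (∀ a, z (C.msgIn a) = encIn x a) ∧
        (∀ j, j ∉ Set.range (C.memIn x) → j ∉ Set.range C.msgIn → z j = false) then 1 else 0

/-- The product of the gates, the head of the list being applied first. -/
def unitary (C : Circuit encIn encOut m m') : Op C.width :=
  C.gates.foldl (fun M g => g.toOp * M) 1

open Classical in
/-- The (unnormalised) state of the kept wires when the measured wires show `encOut y`. -/
def run (C : Circuit encIn encOut m m') (x : α) (y : β) (ρ : Op (m x)) : Op (m' y) :=
  Matrix.of fun b b' =>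
    ∑ z : Reg C.width, ∑ z' : Reg C.width,
      if (∀ k, z (C.msgOut k) = encOut y k) ∧ (∀ k, z' (C.msgOut k) = encOut y k) ∧
          (∀ i, z (C.memOut y i) = b i) ∧ (∀ i, z' (C.memOut y i) = b' i) ∧
          (∀ j, j ∉ Set.range (C.memOut y) → z j = z' j) then
        ((C.unitary * C.load x) * ρ * (C.unitary * C.load x)ᴴ) z z'
      else 0

/-- The circuit implements the instrument exactly. -/
def Implements [Fintype β] (C : Circuit encIn encOut m m') (I : Instrument α β m m') : Prop :=
  ∀ x y ρ, I.map x y ρ = C.run x y ρ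

/-- Number of wires plus number of gates (plus one, so that every circuit counts). -/
def size (C : Circuit encIn encOut m m') : ℕ := C.width + C.gates.length + 1

end Circuit

open Classical in
/-- One-hot encoding of a fixed finite alphabet. -/
def oneHot {α : Type} (x : α) : α → Bool := fun x' => decide (x' = x)

/-- The encoding of a pair of one-hot encoded letters. -/
def oneHot₂ {α β : Type} (p : α × β) : α ⊕ β → Bool := Sum.elim (oneHot p.1) (oneHot p.2)

/-- The encoding of the trivial message, on no wire. -/
def encUnit : Unit → Empty → Bool := fun _ _ => false

/-- A bit on one wire. -/
def encBool : Bool → Unit → Bool := fun b _ => b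

/-! ## Messages, transcripts, ideal resources -/

/-- Classical messages: bit strings of length `ℓ`. -/
abbrev Msg (ℓ : ℕ) : Type := Fin ℓ → Bool

/-- What went over the classical channel in `N` rounds; in each round first a message from the
client side to the server side and then a message back. -/
abbrev Transcript (N ℓ : ℕ) : Type := Fin N → Msg ℓ × Msg ℓ

/-- The message to the server side in round `i`. -/
def Transcript.down {N ℓ : ℕ} (t : Transcript N ℓ) (i : ℕ) : Msg ℓ :=
  if h : i < N then (t ⟨i, h⟩).1 else fun _ => false

/-- The message to the client side in round `i`. -/
def Transcript.up {N ℓ : ℕ} (t : Transcript N ℓ) (i : ℕ) : Msg ℓ :=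
  if h : i < N then (t ⟨i, h⟩).2 else fun _ => false

/-- An ideal resource with a left (client) and a right (server) interface. It takes an input
`x : X` on the left and a bit `c` on the right (`c = false` being the honest choice, enforced by
the filter), and then outputs once on both interfaces: a letter `y : Y` on the left, and on the
right a letter `r : R` together with `q r` qubits. The (unnormalised) state of those qubits
jointly with the event that the letters are `y` and `r` is `out x c y r`. -/
structure IdealResource where
  X : Type
  Y : Type
  R : Type
  [fX : Fintype X]
  [fY : Fintype Y]
  [fR : Fintype R]
  q : R → ℕ
  out : X → Bool → Y → (r : R) → Op (q r)
  pos : ∀ x c y r, (out x c y r).PosSemidef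
  norm : ∀ x c, ∑ y, ∑ r, (out x c y r).trace = 1

attribute [instance] IdealResource.fX IdealResource.fY IdealResource.fR

/-! ## The converters of a protocol over the classical channel -/

/-- A client converter `π_A`: it receives the left input, exchanges `N` rounds of classical messages
on its inner interface, and outputs a letter on the left. -/
structure Client (S : IdealResource) (N ℓ : ℕ) where
  pre : ℕ → ℕ
  mid : ℕ → ℕ
  start : Instrument S.X Unit (fun _ => 0) (fun _ => pre 0)
  send : (i : ℕ) → Instrument Unit (Msg ℓ) (fun _ => pre i) (fun _ => mid i)
  recv : (i : ℕ) → Instrument (Msg ℓ) Unit (fun _ => mid i) (fun _ => pre (i + 1))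
  finish : Instrument Unit S.Y (fun _ => pre N) (fun _ => 0)

/-- The unnormalised memory of the client after `i` rounds with transcript `t`. -/
def Client.state {S : IdealResource} {N ℓ : ℕ} (A : Client S N ℓ) (x : S.X)
    (t : Transcript N ℓ) : (i : ℕ) → Op (A.pre i)
  | 0 => A.start.map x () 1
  | i + 1 => (A.recv i).map (t.up i) () ((A.send i).map () (t.down i) (A.state x t i))

/-- The probability that the client, on left input `x` and when receiving the messages `up` of `t`,
sends the messages `down` of `t` and finally outputs `y`. -/
def Client.weight {S : IdealResource} {N ℓ : ℕ} (A : Client S N ℓ) (x : S.X)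
    (t : Transcript N ℓ) (y : S.Y) : ℂ :=
  (A.finish.map () y (A.state x t N)).trace

/-- A server converter `π_B`: it exchanges `N` rounds of classical messages on its inner interface
and outputs a letter with the corresponding number of qubits on the right. -/
structure Server (S : IdealResource) (N ℓ : ℕ) where
  mem : ℕ → ℕ
  start : Instrument Unit Unit (fun _ => 0) (fun _ => mem 0)
  step : (i : ℕ) → Instrument (Msg ℓ) (Msg ℓ) (fun _ => mem i) (fun _ => mem (i + 1))
  finish : Instrument Unit S.R (fun _ => mem N) S.q

/-- The unnormalised memory of the server after `i` rounds with transcript `t`. -/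
def Server.state {S : IdealResource} {N ℓ : ℕ} (B : Server S N ℓ)
    (t : Transcript N ℓ) : (i : ℕ) → Op (B.mem i)
  | 0 => B.start.map () () 1
  | i + 1 => (B.step i).map (t.down i) (t.up i) (B.state t i)

/-- The unnormalised right output of the server after the transcript `t`. -/
def Server.output {S : IdealResource} {N ℓ : ℕ} (B : Server S N ℓ)
    (t : Transcript N ℓ) (r : S.R) : Op (S.q r) :=
  B.finish.map () r (B.state t N)

/-- The server converter is implemented by circuits of total size at most `s`. -/
def Server.HasSize {S : IdealResource} {N ℓ : ℕ} (B : Server S N ℓ) (s : ℕ) : Prop :=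
  ∃ (c₀ : Circuit encUnit encUnit (fun _ => 0) (fun _ => B.mem 0))
    (c : (i : Fin N) → Circuit (fun a : Msg ℓ => a) (fun b : Msg ℓ => b)
      (fun _ => B.mem i) (fun _ => B.mem (i + 1)))
    (c₁ : Circuit encUnit (oneHot (α := S.R)) (fun _ => B.mem N) S.q),
    c₀.Implements B.start ∧ (∀ i : Fin N, (c i).Implements (B.step i)) ∧
      c₁.Implements B.finish ∧ c₀.size + (∑ i, (c i).size) + c₁.size ≤ s

/-! ## Simulators -/

/-- The number of qubits that come with an answer of the resource (`none`: no answer). -/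
def IdealResource.ansQubits (S : IdealResource) : Option S.R → ℕ
  | none => 0
  | some r => S.q r

/-- A simulator `σ`: its inner interface is connected to the right interface of the resource and its
outer interface is the server side of the classical channel. Before each message that it sends,
and once more after the last round, it may send a bit `c` to the resource (outcome `some c` of
`ask`) or not (outcome `none`); it then processes the answer, if there is one. -/
structure Simulator (S : IdealResource) (N ℓ : ℕ) where
  pre : ℕ → ℕ
  mid : ℕ → ℕ
  post : ℕ → ℕ
  start : Instrument Unit Unit (fun _ => 0) (fun _ => pre 0)
  ask : (i : ℕ) → Instrument Unit (Option Bool) (fun _ => pre i) (fun _ => mid i)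
  send : (i : ℕ) → Instrument (Option S.R) (Msg ℓ) (fun r => mid i + S.ansQubits r)
    (fun _ => post i)
  recv : (i : ℕ) → Instrument (Msg ℓ) Unit (fun _ => post i) (fun _ => pre (i + 1))

namespace Simulator

variable {S : IdealResource} {N ℓ : ℕ}

/-- The joint situation after the simulator had the opportunity to address the resource. The index
`o : Option S.Y` is the letter that the resource has output on the left so far (`none`: it has not
been triggered yet). The resource answers the first bit `c` only. -/
def afterAsk (σ : Simulator S N ℓ) (x : S.X) (i : ℕ) (ρ : Option S.Y → Op (σ.pre i)) :
    Option S.Y → (r : Option S.R) → Op (σ.mid i + S.ansQubits r)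
  | none, none => join ((σ.ask i).map () none (ρ none)) (1 : Op 0)
  | none, some _ => 0
  | some y, none => join (∑ o : Option Bool, (σ.ask i).map () o (ρ (some y))) (1 : Op 0)
  | some y, some r => ∑ c : Bool, join ((σ.ask i).map () (some c) (ρ none)) (S.out x c y r)

/-- The unnormalised memory of the simulator after `i` rounds with transcript `t`, jointly with the
left output of the resource so far. -/
def state (σ : Simulator S N ℓ) (x : S.X) (t : Transcript N ℓ) :
    (i : ℕ) → Option S.Y → Op (σ.pre i)
  | 0 => fun o => match o with
      | none => σ.start.map () () 1
      | some _ => 0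
  | i + 1 => fun o => (σ.recv i).map (t.up i) ()
      (∑ r, (σ.send i).map r (t.down i) (σ.afterAsk x i (σ.state x t i) o r))

/-- The probability that the resource with the simulator attached, on left input `x` and when
receiving the messages `up` of `t`, sends the messages `down` of `t` and has the left output `o`. -/
def weight (σ : Simulator S N ℓ) (x : S.X) (t : Transcript N ℓ) (o : Option S.Y) : ℂ :=
  ∑ r, (σ.afterAsk x N (σ.state x t N) o r).trace

end Simulator

/-! ## Availability -/

/-- A distinguisher for systems that take a left input and then output on the left and on the right:
it chooses the left input, keeping a quantum memory, and decides from all that it gets. -/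
structure OutputDistinguisher (S : IdealResource) where
  mem : ℕ
  start : Instrument Unit S.X (fun _ => 0) (fun _ => mem)
  decide : Instrument (S.Y × S.R) Bool (fun p => mem + S.q p.2) (fun _ => 0)

/-- The probability that the distinguisher outputs `1` when it interacts with the system that maps
the left input `x` to the (unnormalised) outputs `τ x y r`. -/
def OutputDistinguisher.accept {S : IdealResource} (D : OutputDistinguisher S)
    (τ : S.X → S.Y → (r : S.R) → Op (S.q r)) : ℝ :=
  (∑ x, ∑ y, ∑ r, (D.decide.map (y, r) true (join (D.start.map () x 1) (τ x y r))).trace).re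

/-- The distinguisher is implemented by circuits of total size at most `s`. -/
def OutputDistinguisher.HasSize {S : IdealResource} (D : OutputDistinguisher S) (s : ℕ) : Prop :=
  ∃ (c₀ : Circuit encUnit (oneHot (α := S.X)) (fun _ => 0) (fun _ => D.mem))
    (c₁ : Circuit (oneHot₂ (α := S.Y) (β := S.R)) encBool (fun p => D.mem + S.q p.2)
      (fun _ => 0)),
    c₀.Implements D.start ∧ c₁.Implements D.decide ∧ c₀.size + c₁.size ≤ s

/-- The ideal system `S ⊢`, in which the filter sets `c = 0`. -/
def IdealResource.filtered (S : IdealResource) (x : S.X) (y : S.Y) (r : S.R) : Op (S.q r) :=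
  S.out x false y r

/-- The real system `π_A 𝒞 π_B` with both parties honest. -/
def honestRun {S : IdealResource} {N ℓ : ℕ} (A : Client S N ℓ) (B : Server S N ℓ)
    (x : S.X) (y : S.Y) (r : S.R) : Op (S.q r) :=
  ∑ t : Transcript N ℓ, A.weight x t y • B.output t r

/-- The advantage of `D` between `π_A 𝒞 π_B` and `S ⊢`. -/
def OutputDistinguisher.advantage {S : IdealResource} {N ℓ : ℕ} (D : OutputDistinguisher S)
    (A : Client S N ℓ) (B : Server S N ℓ) : ℝ :=
  |D.accept (honestRun A B) - D.accept S.filtered|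

/-! ## Security -/

/-- A distinguisher for systems with a left input, a left output and the server side of the
classical channel on the right: it chooses the left input, plays the server's part in the `N`
rounds and then, given the left output (`none` if there was none), decides. -/
structure ChannelDistinguisher (S : IdealResource) (N ℓ : ℕ) where
  mem : ℕ → ℕ
  start : Instrument Unit S.X (fun _ => 0) (fun _ => mem 0)
  step : (i : ℕ) → Instrument (Msg ℓ) (Msg ℓ) (fun _ => mem i) (fun _ => mem (i + 1))
  decide : Instrument (Option S.Y) Bool (fun _ => mem N) (fun _ => 0)

namespace ChannelDistinguisher

variable {S : IdealResource} {N ℓ : ℕ}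

/-- The unnormalised memory of the distinguisher after `i` rounds with transcript `t`, jointly with
the event that it chose the left input `x`. -/
def state (D : ChannelDistinguisher S N ℓ) (x : S.X) (t : Transcript N ℓ) :
    (i : ℕ) → Op (D.mem i)
  | 0 => D.start.map () x 1
  | i + 1 => (D.step i).map (t.down i) (t.up i) (D.state x t i)

/-- The probability that the distinguisher outputs `1` when it interacts with the system that
behaves according to the probabilities `p x t o`. Since all communication is classical, the two
sides are in a product state conditionally on the transcript. -/
def accept (D : ChannelDistinguisher S N ℓ)
    (p : S.X → Transcript N ℓ → Option S.Y → ℂ) : ℝ :=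
  (∑ x, ∑ t : Transcript N ℓ, ∑ o,
    (D.decide.map o true (D.state x t N)).trace * p x t o).re

/-- The distinguisher is implemented by circuits of total size at most `s`. -/
def HasSize (D : ChannelDistinguisher S N ℓ) (s : ℕ) : Prop :=
  ∃ (c₀ : Circuit encUnit (oneHot (α := S.X)) (fun _ => 0) (fun _ => D.mem 0))
    (c : (i : Fin N) → Circuit (fun a : Msg ℓ => a) (fun b : Msg ℓ => b)
      (fun _ => D.mem i) (fun _ => D.mem (i + 1)))
    (c₁ : Circuit (oneHot (α := Option S.Y)) encBool (fun _ => D.mem N) (fun _ => 0)),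
    c₀.Implements D.start ∧ (∀ i : Fin N, (c i).Implements (D.step i)) ∧
      c₁.Implements D.decide ∧ c₀.size + (∑ i, (c i).size) + c₁.size ≤ s

end ChannelDistinguisher

/-- The real system `π_A 𝒞`, with the right end of the classical channel open. -/
def clientSystem {S : IdealResource} {N ℓ : ℕ} (A : Client S N ℓ)
    (x : S.X) (t : Transcript N ℓ) : Option S.Y → ℂ
  | none => 0
  | some y => A.weight x t y

/-- The advantage of `D` between `π_A 𝒞` and `S σ`. -/
def ChannelDistinguisher.advantage {S : IdealResource} {N ℓ : ℕ}
    (D : ChannelDistinguisher S N ℓ) (A : Client S N ℓ) (σ : Simulator S N ℓ) : ℝ :=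
  |D.accept (clientSystem A) - D.accept σ.weight|

/-! ## Classical realizability -/

/-- `S` is `ε`-classically-realizable against unbounded distinguishers: some protocol
`(π_A, π_B)` over the classical channel satisfies `π_A 𝒞 π_B ≈_ε S ⊢` (availability) and
`π_A 𝒞 ≈_ε S σ` for some simulator `σ` (security). -/
def ClassicallyRealizable (S : IdealResource) (ε : ℝ) : Prop :=
  ∃ (N ℓ : ℕ) (A : Client S N ℓ) (B : Server S N ℓ),
    (∀ D : OutputDistinguisher S, D.advantage A B ≤ ε) ∧
    ∃ σ : Simulator S N ℓ, ∀ D : ChannelDistinguisher S N ℓ, D.advantage A σ ≤ ε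

/-- Polynomially bounded functions. -/
def PolyBounded (s : ℕ → ℕ) : Prop := ∃ p : Polynomial ℕ, ∀ n, s n ≤ p.eval n

/-- `S` is `ε`-classically-realizable against quantum polynomial-time (non-uniform) distinguishers:
the same with families indexed by the security parameter `n`, where the server's converter and
the distinguishers are given by circuits of polynomial size, and where each family of
distinguishers has advantage at most `ε n` for all large `n`. No bound is put on the client and on
the simulator. -/
def ComputationallyClassicallyRealizable (S : IdealResource) (ε : ℕ → ℝ) : Prop :=
  ∃ (N ℓ : ℕ → ℕ) (A : (n : ℕ) → Client S (N n) (ℓ n)) (B : (n : ℕ) → Server S (N n) (ℓ n)),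
    (∃ s : ℕ → ℕ, PolyBounded s ∧ ∀ n, (B n).HasSize (s n)) ∧
    (∀ D : ℕ → OutputDistinguisher S,
      (∃ s : ℕ → ℕ, PolyBounded s ∧ ∀ n, (D n).HasSize (s n)) →
        ∀ᶠ n in atTop, (D n).advantage (A n) (B n) ≤ ε n) ∧
    ∃ σ : (n : ℕ) → Simulator S (N n) (ℓ n),
      ∀ D : (n : ℕ) → ChannelDistinguisher S (N n) (ℓ n),
        (∃ s : ℕ → ℕ, PolyBounded s ∧ ∀ n, (D n).HasSize (s n)) →
          ∀ᶠ n in atTop, (D n).advantage (A n) (σ n) ≤ ε n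

/-! ## The verifiable remote state preparation resource -/

/-- The client's choice of basis. -/
inductive Basis : Type
  | X
  | Z
  deriving DecidableEq

instance : Fintype Basis where
  elems := {.X, .Z}
  complete := fun W => by cases W <;> simp

/-- Left outputs: `ERR`, a bit `b`, or an angle `θ = k π / 4`. -/
inductive LeftOut : Type
  | err
  | bit (b : Bool)
  | angle (k : Fin 8)
  deriving DecidableEq

instance : Fintype LeftOut where
  elems := {.err} ∪ Finset.univ.image LeftOut.bit ∪ Finset.univ.image LeftOut.angle
  complete := fun y => by cases y <;> simp

/-- Right outputs: `ERR`, or a qubit. -/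
inductive RightOut : Type
  | err
  | qubit
  deriving DecidableEq

instance : Fintype RightOut where
  elems := {.err, .qubit}
  complete := fun r => by cases r <;> simp

/-- The number of qubits of a right output. -/
def RightOut.qubits : RightOut → ℕ
  | .err => 0
  | .qubit => 1

/-- The projector `|v⟩⟨v|`. -/
def proj (v : Reg 1 → ℂ) : Op 1 := Matrix.vecMulVec v (star v)

/-- The computational basis vector `|b⟩`. -/
def ketBit (b : Bool) : Reg 1 → ℂ := fun z => if z 0 = b then 1 else 0

/-- The vector `|+_θ⟩ = (|0⟩ + e^{iθ} |1⟩) / √2`. -/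
def ketPlus (θ : ℝ) : Reg 1 → ℂ := fun z =>
  ((1 / Real.sqrt 2 : ℝ) : ℂ) * if z 0 then Complex.exp (Complex.I * (θ : ℂ)) else 1

/-- The outputs of `RSP_V`. -/
def rspVOut (W : Basis) (c : Bool) : LeftOut → (r : RightOut) → Op r.qubits
  | .err, .err => if c = true then 1 else 0
  | .bit b, .qubit => if c = false ∧ W = .Z then (1 / 2 : ℂ) • proj (ketBit b) else 0
  | .angle k, .qubit =>
      if c = false ∧ W = .X then (1 / 8 : ℂ) • proj (ketPlus ((k : ℕ) * (Real.pi / 4))) else 0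
  | .err, .qubit => 0
  | .bit _, .err => 0
  | .angle _, .err => 0

theorem proj_posSemidef (v : Reg 1 → ℂ) : (proj v).PosSemidef :=
  Matrix.posSemidef_vecMulVec_self_star v

theorem rspVOut_posSemidef (W : Basis) (c : Bool) (y : LeftOut) (r : RightOut) :
    (rspVOut W c y r).PosSemidef := by
  have h : ∀ (p : Prop) [Decidable p] {m : ℕ} (M : Op m), M.PosSemidef →
      (if p then M else 0).PosSemidef := by
    intro p _ m M hM
    split_ifs
    · exact hM
    · exact Matrix.PosSemidef.zero
  match y, r with
  | .err, .err => exact h _ _ Matrix.PosSemidef.one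
  | .bit b, .qubit =>
    exact h _ _ (Matrix.PosSemidef.smul (proj_posSemidef _) (by norm_num [Complex.le_def]))
  | .angle k, .qubit =>
    exact h _ _ (Matrix.PosSemidef.smul (proj_posSemidef _) (by norm_num [Complex.le_def]))
  | .err, .qubit => exact Matrix.PosSemidef.zero
  | .bit _, .err => exact Matrix.PosSemidef.zero
  | .angle _, .err => exact Matrix.PosSemidef.zero

theorem trace_proj (v : Reg 1 → ℂ) :
    (proj v).trace = v (fun _ => false) * star (v fun _ => false) +
      v (fun _ => true) * star (v fun _ => true) := by
  have e : ∀ f : Reg 1 → ℂ, ∑ z, f z = f (fun _ => false) + f (fun _ => true) := by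
    intro f
    rw [← (Equiv.funUnique (Fin 1) Bool).symm.sum_comp, Fintype.sum_bool, add_comm]
    rfl
  simp only [proj, Matrix.trace, Matrix.diag_apply, Matrix.vecMulVec_apply, e, Pi.star_apply]

theorem trace_ketBit (b : Bool) : (proj (ketBit b)).trace = 1 := by
  rw [trace_proj]; cases b <;> simp [ketBit]

theorem trace_ketPlus (θ : ℝ) : (proj (ketPlus θ)).trace = 1 := by
  have h2 : ((Real.sqrt 2 : ℝ) : ℂ) * ((Real.sqrt 2 : ℝ) : ℂ) = 2 := by
    rw [← Complex.ofReal_mul, Real.mul_self_sqrt (by norm_num)]; norm_num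
  have h1 : Complex.exp (Complex.I * (θ : ℂ)) * star (Complex.exp (Complex.I * (θ : ℂ))) = 1 := by
    rw [Complex.star_def, ← Complex.exp_conj, ← Complex.exp_add]
    simp
  have h3 : ((1 / Real.sqrt 2 : ℝ) : ℂ) * ((1 / Real.sqrt 2 : ℝ) : ℂ) = 1 / 2 := by
    push_cast
    rw [div_mul_div_comm, h2]; norm_num
  have h4 : star (((1 / Real.sqrt 2 : ℝ) : ℂ)) = ((1 / Real.sqrt 2 : ℝ) : ℂ) :=
    Complex.conj_ofReal _
  rw [trace_proj]
  simp only [ketPlus, star_mul', h4, Bool.false_eq_true, if_false, if_true, mul_one]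
  calc _ = ((1 / Real.sqrt 2 : ℝ) : ℂ) * ((1 / Real.sqrt 2 : ℝ) : ℂ) *
        (1 + Complex.exp (Complex.I * (θ : ℂ)) * star (Complex.exp (Complex.I * (θ : ℂ)))) := by
          ring
    _ = 1 := by rw [h3, h1]; norm_num

theorem sum_rightOut (f : RightOut → ℂ) : ∑ r, f r = f .err + f .qubit := by
  have h : (Finset.univ : Finset RightOut) = {.err, .qubit} := rfl
  rw [h, Finset.sum_pair (by decide)]

theorem sum_leftOut (f : LeftOut → ℂ) :
    ∑ y, f y = f .err + ∑ b, f (.bit b) + ∑ k, f (.angle k) := by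
  have h : (Finset.univ : Finset LeftOut) = {.err} ∪ Finset.univ.image LeftOut.bit ∪
      Finset.univ.image LeftOut.angle := rfl
  rw [h, Finset.sum_union (by decide), Finset.sum_union (by decide), Finset.sum_singleton,
    Finset.sum_image (fun a _ b _ e => LeftOut.bit.inj e),
    Finset.sum_image (fun a _ b _ e => LeftOut.angle.inj e)]

theorem rspVOut_norm (W : Basis) (c : Bool) :
    ∑ y, ∑ r, (rspVOut W c y r).trace = 1 := by
  have h (p : Prop) [Decidable p] {m : ℕ} (M : Op m) :
      (if p then M else 0).trace = if p then M.trace else 0 := by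
    split_ifs
    · rfl
    · exact Matrix.trace_zero _ _
  have h1 : (rspVOut W c .err .err).trace = if c = true then 1 else 0 :=
    (h (c = true) (1 : Op 0)).trans (by simp [Matrix.trace_one])
  have h2 (b : Bool) : (rspVOut W c (.bit b) .qubit).trace =
      if c = false ∧ W = .Z then 1 / 2 else 0 :=
    (h (c = false ∧ W = .Z) ((1 / 2 : ℂ) • proj (ketBit b))).trans
      (by rw [Matrix.trace_smul, trace_ketBit, smul_eq_mul, mul_one])
  have h3 (k : Fin 8) : (rspVOut W c (.angle k) .qubit).trace =
      if c = false ∧ W = .X then 1 / 8 else 0 :=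
    (h (c = false ∧ W = .X) ((1 / 8 : ℂ) • proj (ketPlus ((k : ℕ) * (Real.pi / 4))))).trans
      (by rw [Matrix.trace_smul, trace_ketPlus, smul_eq_mul, mul_one])
  have h4 : (rspVOut W c .err .qubit).trace = 0 := Matrix.trace_zero _ _
  have h5 (b : Bool) : (rspVOut W c (.bit b) .err).trace = 0 := Matrix.trace_zero _ _
  have h6 (k : Fin 8) : (rspVOut W c (.angle k) .err).trace = 0 := Matrix.trace_zero _ _
  simp only [sum_leftOut, sum_rightOut, h1, h2, h3, h4, h5, h6]
  cases W <;> cases c <;> simp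

/-- The verifiable remote state preparation resource `RSP_V`: the left input is `W ∈ {X, Z}`; for
`c = 1` both interfaces get `ERR`; for `c = 0` and `W = Z` a uniform bit `b` is output on the left
and `|b⟩` on the right; for `c = 0` and `W = X` a uniform angle `θ ∈ {0, π/4, …, 7π/4}` is output on
the left and `|+_θ⟩` on the right. -/
abbrev RSPV : IdealResource where
  X := Basis
  Y := LeftOut
  R := RightOut
  q := RightOut.qubits
  out := rspVOut
  pos := rspVOut_posSemidef
  norm := rspVOut_norm

end RemoteState

end

open Matrix Filter
open scoped ComplexOrder
noncomputable section
namespace RemoteState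

/-! ## Operators acting on some of the wires -/

/-! Over a classical channel the two ends are correlated only through the transcript, and this stays
true when the honest server talks to the simulator instead of the client. That hybrid system would
have to reproduce the qubit of `RSP_V` out of classical messages, so it is a measure-and-prepare
channel, and such channels cannot transmit the four states |0⟩, |1⟩, |+⟩, |-⟩ faithfully.

In detail, fix a transcript t. Up to the factor P(y), the probability of y as left output, the
simulator's weight for a left output y other than `ERR` is F_t(ψ_y), with ψ_y the state that the
resource emits and F_t a positive functional independent of the input
(`Simulator.exists_weight_eq`). The server's output is a positive operator, hence gives another
positive functional G_t on test projectors. Positivity confines the X and Z components of each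
functional to a Bloch disc (`bloch_le`), and Cauchy–Schwarz then shows that the four tests of the
correct state succeed in total at most three times as often as the four tests of the orthogonal
state (`measure_and_prepare_le`). The ideal resource always passes the former and never the latter.

The hybrid is close to the ideal system by two uses of the hypotheses. A channel distinguisher that
runs the honest server and then tests the qubit cannot separate client from simulator by more than
ε; run with the real client it accepts exactly as often as the bare output test on the honest
protocol (`accept_honestRun`), which is ε-close to ideal. Eight such tests give ε ≥ 1/40
(`inv_forty_le_of_tests`).

The computational statement uses the same eight tests. It only remains to realise them exactly by
circuits whose size exceeds that of the server by a constant, which is the purpose of the circuit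
constructions (`outputTest_hasSize`, `channelTest_hasSize`). The client and the simulator are never
executed by the distinguisher, so their complexity plays no role. -/

open Classical in
/-- The operator on `w` wires that acts as `M` on the wires `f` and trivially elsewhere. -/
def embedOp {a w : ℕ} (f : Fin a ↪ Fin w) (M : Op a) : Op w :=
  Matrix.of fun z' z =>
    if ∀ j, j ∉ Set.range f → z' j = z j then M (fun i => z' (f i)) (fun i => z (f i)) else 0

theorem Gate.toOp_eq {w : ℕ} (g : Gate w) : g.toOp = embedOp g.wires (g.U : Op g.arity) := rfl

theorem extend_self_apply {a w : ℕ} (f : Fin a ↪ Fin w) (v : Reg a) (z : Reg w) (i : Fin a) :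
    Function.extend f v z (f i) = v i := f.injective.extend_apply v z i

theorem extend_of_notMem {a w : ℕ} (f : Fin a ↪ Fin w) (v : Reg a) (z : Reg w) {j : Fin w}
    (hj : j ∉ Set.range f) : Function.extend f v z j = z j :=
  Function.extend_apply' _ _ _ (by simpa using hj)

theorem extend_comp_self {a w : ℕ} (f : Fin a ↪ Fin w) (z z' : Reg w)
    (h : ∀ j, j ∉ Set.range f → z' j = z j) :
    Function.extend f (fun i => z (f i)) z' = z := by
  funext j
  by_cases hj : j ∈ Set.range f
  · obtain ⟨i, rfl⟩ := hj
    exact extend_self_apply f _ _ i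
  · rw [extend_of_notMem f _ _ hj, h j hj]

theorem embedOp_mul_apply {a w : ℕ} {κ : Type*} (f : Fin a ↪ Fin w) (M : Op a)
    (A : Matrix (Reg w) κ ℂ) (z : Reg w) (b : κ) :
    (embedOp f M * A) z b =
      ∑ v : Reg a, M (fun i => z (f i)) v * A (Function.extend f v z) b := by
  classical
  rw [Matrix.mul_apply]
  simp only [embedOp, Matrix.of_apply, ite_mul, zero_mul]
  rw [← Finset.sum_filter]
  symm
  refine Finset.sum_bij' (fun v _ => Function.extend f v z) (fun z' _ i => z' (f i)) ?_ ?_ ?_ ?_ ?_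
  · intro v _
    simp only [Finset.mem_filter, Finset.mem_univ, true_and]
    intro j hj
    exact (extend_of_notMem f v z hj).symm
  · intro _ _; exact Finset.mem_univ _
  · intro v _; funext i; exact extend_self_apply f v z i
  · intro z' hz'
    simp only [Finset.mem_filter, Finset.mem_univ, true_and] at hz'
    exact extend_comp_self f z' z hz'
  · intro v _
    congr 2
    funext i; exact (extend_self_apply f v z i).symm

theorem embedOp_mul {a w : ℕ} (f : Fin a ↪ Fin w) (M M' : Op a) :
    embedOp f M * embedOp f M' = embedOp f (M * M') := by
  classical
  ext z z'
  rw [embedOp_mul_apply]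
  simp only [embedOp, Matrix.of_apply, extend_self_apply]
  have h : ∀ v : Reg a, (∀ j, j ∉ Set.range f → Function.extend f v z j = z' j) ↔
      ∀ j, j ∉ Set.range f → z j = z' j := fun v =>
    forall₂_congr fun j hj => by rw [extend_of_notMem f v z hj]
  simp only [h]
  split_ifs
  · rw [Matrix.mul_apply]
  · simp

theorem embedOp_one {a w : ℕ} (f : Fin a ↪ Fin w) : embedOp f (1 : Op a) = 1 := by
  classical
  ext z z'
  simp only [embedOp, Matrix.of_apply, Matrix.one_apply]
  by_cases h : z = z'
  · subst h; simp
  · rw [if_neg h]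
    split_ifs with h1 h2
    · refine absurd (funext fun j => ?_) h
      by_cases hj : j ∈ Set.range f
      · obtain ⟨i, rfl⟩ := hj; exact congrFun h2 i
      · exact h1 j hj
    · rfl
    · rfl

theorem embedOp_conjTranspose {a w : ℕ} (f : Fin a ↪ Fin w) (M : Op a) :
    (embedOp f M)ᴴ = embedOp f Mᴴ := by
  classical
  ext z z'
  simp only [embedOp, Matrix.of_apply, Matrix.conjTranspose_apply]
  have h : (∀ j, j ∉ Set.range f → z' j = z j) ↔ ∀ j, j ∉ Set.range f → z j = z' j :=
    forall₂_congr fun _ _ => eq_comm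
  simp only [h]
  split_ifs <;> simp

theorem embedOp_trans {a w n : ℕ} (g : Fin a ↪ Fin w) (f : Fin w ↪ Fin n) (M : Op a) :
    embedOp f (embedOp g M) = embedOp (g.trans f) M := by
  classical
  ext z z'
  simp only [embedOp, Matrix.of_apply, Function.Embedding.trans_apply, ← ite_and]
  congr 1
  apply propext
  constructor
  · rintro ⟨h1, h2⟩ j hj
    by_cases hf : j ∈ Set.range f
    · obtain ⟨i, rfl⟩ := hf
      exact h2 i fun ⟨k, hk⟩ => hj ⟨k, by simp [hk]⟩
    · exact h1 j hf
  · intro h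
    refine ⟨fun j hj => h j ?_, fun i hi => h (f i) ?_⟩
    · rintro ⟨k, rfl⟩; exact hj ⟨g k, rfl⟩
    · rintro ⟨k, hk⟩; exact hi ⟨k, f.injective hk⟩

theorem Gate.conjTranspose_toOp_mul {w : ℕ} (g : Gate w) : g.toOpᴴ * g.toOp = 1 := by
  have h : ((g.U : Op g.arity))ᴴ * (g.U : Op g.arity) = 1 :=
    (Matrix.mem_unitaryGroup_iff'.1 g.U.2)
  rw [g.toOp_eq, embedOp_conjTranspose, embedOp_mul, h, embedOp_one]

/-- The product of a list of gates, the head being applied first. -/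
def gateProd {w : ℕ} (l : List (Gate w)) : Op w := l.foldl (fun M g => g.toOp * M) 1

theorem foldl_gate {w : ℕ} (l : List (Gate w)) (M : Op w) :
    l.foldl (fun M g => g.toOp * M) M = gateProd l * M := by
  induction l generalizing M with
  | nil => simp [gateProd]
  | cons g l ih =>
    rw [gateProd, List.foldl_cons, List.foldl_cons, ih, ih (g.toOp * 1)]
    simp [Matrix.mul_assoc]

theorem gateProd_cons {w : ℕ} (g : Gate w) (l : List (Gate w)) :
    gateProd (g :: l) = gateProd l * g.toOp := by
  rw [gateProd, List.foldl_cons, foldl_gate]; simp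

theorem gateProd_nil {w : ℕ} : gateProd ([] : List (Gate w)) = 1 := rfl

theorem gateProd_append {w : ℕ} (l l' : List (Gate w)) :
    gateProd (l ++ l') = gateProd l' * gateProd l := by
  rw [gateProd, List.foldl_append, foldl_gate]; rfl

theorem conjTranspose_gateProd_mul {w : ℕ} (l : List (Gate w)) :
    (gateProd l)ᴴ * gateProd l = 1 := by
  induction l with
  | nil => simp [gateProd_nil]
  | cons g l ih =>
    rw [gateProd_cons, Matrix.conjTranspose_mul, Matrix.mul_assoc, ← Matrix.mul_assoc _ (gateProd l),
      ih, Matrix.one_mul, g.conjTranspose_toOp_mul]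

/-- The same gate on a larger set of wires. -/
def Gate.lift {w n : ℕ} (f : Fin w ↪ Fin n) (g : Gate w) : Gate n :=
  ⟨g.arity, g.arity_le, g.wires.trans f, g.U⟩

/-- This lets a given circuit run unchanged on part of a larger register, with further gates
appended. -/
theorem gateProd_lift {w n : ℕ} (f : Fin w ↪ Fin n) (l : List (Gate w)) :
    gateProd (l.map (Gate.lift f)) = embedOp f (gateProd l) := by
  induction l with
  | nil => simp [gateProd_nil, embedOp_one]
  | cons g l ih =>
    rw [List.map_cons, gateProd_cons, gateProd_cons, ih, ← embedOp_mul]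
    congr 1
    rw [g.toOp_eq, embedOp_trans]
    rfl

namespace Circuit

variable {α β A B : Type} {encIn : α → A → Bool} {encOut : β → B → Bool}
  {m : α → ℕ} {m' : β → ℕ}

/-- The amplitudes after the gates, as a function of the initial memory. -/
def amp (C : Circuit encIn encOut m m') (x : α) : Matrix (Reg C.width) (Reg (m x)) ℂ :=
  gateProd C.gates * C.load x

/-- Each memory label `b` has exactly one compatible label `z₀` of all wires, and `b` can be read
off from it; the columns are therefore distinct basis vectors. -/
theorem conjTranspose_load_mul (C : Circuit encIn encOut m m') (x : α) :
    (C.load x)ᴴ * C.load x = 1 := by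
  classical
  ext b b'
  rw [Matrix.mul_apply, Matrix.one_apply]
  simp only [Matrix.conjTranspose_apply, load, Matrix.of_apply, apply_ite star, star_one, star_zero,
    ite_mul, one_mul, zero_mul]
  set z₀ : Reg C.width := fun j => if h : ∃ i, C.memIn x i = j then b h.choose else
    if h : ∃ a, C.msgIn a = j then encIn x h.choose else false with hz₀
  have h1 : ∀ i, z₀ (C.memIn x i) = b i := by
    intro i
    have h : ∃ i', C.memIn x i' = C.memIn x i := ⟨i, rfl⟩
    rw [hz₀]; simp only [h, dif_pos]
    exact congrArg b ((C.memIn x).injective h.choose_spec)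
  have h2 : ∀ a, z₀ (C.msgIn a) = encIn x a := by
    intro a
    have h' : ¬ ∃ i', C.memIn x i' = C.msgIn a := fun ⟨i, hi⟩ => C.disjoint_in x i a hi
    have h : ∃ a', C.msgIn a' = C.msgIn a := ⟨a, rfl⟩
    rw [hz₀]; simp only [h', h, dif_pos, dif_neg, not_false_eq_true]
    exact congrArg (encIn x) (C.msgIn.injective h.choose_spec)
  have h3 : ∀ j, j ∉ Set.range (C.memIn x) → j ∉ Set.range C.msgIn → z₀ j = false := by
    intro j hj hj'
    rw [hz₀]; simp only [Set.mem_range] at hj hj'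
    simp only [hj, hj', dif_neg, not_false_eq_true]
  rw [Finset.sum_eq_single z₀]
  · rw [if_pos ⟨h1, h2, h3⟩]
    congr 1
    apply propext
    constructor
    · rintro ⟨h, -⟩; funext i; rw [← h1 i, h i]
    · rintro rfl; exact ⟨h1, h2, h3⟩
  · intro z _ hz
    rw [if_neg]
    rintro ⟨g1, g2, g3⟩
    apply hz
    funext j
    by_cases hj : j ∈ Set.range (C.memIn x)
    · obtain ⟨i, rfl⟩ := hj; rw [g1, h1]
    · by_cases hj' : j ∈ Set.range C.msgIn
      · obtain ⟨a, rfl⟩ := hj'; rw [g2, h2]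
      · rw [g3 j hj hj', h3 j hj hj']
  · intro h; exact absurd (Finset.mem_univ _) h

theorem conjTranspose_amp_mul (C : Circuit encIn encOut m m') (x : α) :
    (C.amp x)ᴴ * C.amp x = 1 := by
  rw [amp, Matrix.conjTranspose_mul, Matrix.mul_assoc, ← Matrix.mul_assoc _ (gateProd C.gates),
    conjTranspose_gateProd_mul, Matrix.one_mul, C.conjTranspose_load_mul]

theorem trace_amp (C : Circuit encIn encOut m m') (x : α) (ρ : Op (m x)) :
    (C.amp x * ρ * (C.amp x)ᴴ).trace = ρ.trace := by
  rw [Matrix.trace_mul_comm, ← Matrix.mul_assoc, conjTranspose_amp_mul, Matrix.one_mul]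

end Circuit

/-! ## Elementary gates -/

/-- A single wire. -/
def oneWire {w : ℕ} (j : Fin w) : Fin 1 ↪ Fin w := ⟨fun _ => j, fun _ _ _ => Subsingleton.elim _ _⟩

/-- A gate on a single wire. -/
def gateOne {w : ℕ} (j : Fin w) (U : Matrix.unitaryGroup (Reg 1) ℂ) : Gate w :=
  ⟨1, by norm_num, oneWire j, U⟩

theorem gateOne_mul_apply {w : ℕ} {κ : Type*} (j : Fin w) (U : Matrix.unitaryGroup (Reg 1) ℂ)
    (A : Matrix (Reg w) κ ℂ) (z : Reg w) (b : κ) :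
    ((gateOne j U).toOp * A) z b =
      ∑ v : Reg 1, (U : Op 1) (fun _ => z j) v * A (Function.extend (oneWire j) v z) b :=
  embedOp_mul_apply (oneWire j) _ A z b

/-- The permutation matrix of `π`. -/
def permOp {a : ℕ} (π : Equiv.Perm (Reg a)) : Op a :=
  Matrix.of fun z v => if v = π z then 1 else 0

theorem permOp_mem_unitaryGroup {a : ℕ} (π : Equiv.Perm (Reg a)) :
    permOp π ∈ Matrix.unitaryGroup (Reg a) ℂ := by
  rw [Matrix.mem_unitaryGroup_iff]
  ext z z'
  rw [Matrix.star_eq_conjTranspose, Matrix.mul_apply, Matrix.one_apply]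
  simp only [permOp, Matrix.of_apply, Matrix.conjTranspose_apply, apply_ite star, star_one,
    star_zero, ite_mul, one_mul, zero_mul, Finset.sum_ite_eq', Finset.mem_univ, if_true,
    EmbeddingLike.apply_eq_iff_eq]

theorem embedOp_permOp_mul_apply {a w : ℕ} {κ : Type*} (f : Fin a ↪ Fin w)
    (π : Equiv.Perm (Reg a)) (A : Matrix (Reg w) κ ℂ) (z : Reg w) (b : κ) :
    (embedOp f (permOp π) * A) z b = A (Function.extend f (π fun i => z (f i)) z) b := by
  rw [embedOp_mul_apply]
  simp [permOp]

/-- Swap the last two of three bits unless the first one is `p`. -/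
def swapUnless (p : Bool) : Equiv.Perm (Reg 3) where
  toFun z := if z 0 = p then z else ![z 0, z 2, z 1]
  invFun z := if z 0 = p then z else ![z 0, z 2, z 1]
  left_inv := by cases p <;> decide
  right_inv := by cases p <;> decide

/-- Three wires. -/
def threeWires {w : ℕ} (c t a : Fin w) (h₁ : c ≠ t) (h₂ : c ≠ a) (h₃ : t ≠ a) : Fin 3 ↪ Fin w :=
  ⟨![c, t, a], by
    intro i j h
    fin_cases i <;> fin_cases j <;> simp_all [eq_comm]⟩

/-- Swap the wires `t` and `a` unless the wire `c` shows `p`. -/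
def gateSwapUnless {w : ℕ} (p : Bool) (c t a : Fin w) (h₁ : c ≠ t) (h₂ : c ≠ a) (h₃ : t ≠ a) :
    Gate w :=
  ⟨3, le_rfl, threeWires c t a h₁ h₂ h₃, ⟨_, permOp_mem_unitaryGroup (swapUnless p)⟩⟩

theorem gateSwapUnless_mul_apply {w : ℕ} {κ : Type*} (p : Bool) {c t a : Fin w} (h₁ : c ≠ t)
    (h₂ : c ≠ a) (h₃ : t ≠ a) (A : Matrix (Reg w) κ ℂ) (z : Reg w) (b : κ) :
    ((gateSwapUnless p c t a h₁ h₂ h₃).toOp * A) z b =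
      A (Function.extend (threeWires c t a h₁ h₂ h₃)
        (swapUnless p fun i => z (threeWires c t a h₁ h₂ h₃ i)) z) b :=
  embedOp_permOp_mul_apply _ _ A z b

/-- The amplitudes vanish unless the wire `a` shows `0`. -/
def CleanOn {w : ℕ} {κ : Type*} (a : Fin w) (A : Matrix (Reg w) κ ℂ) : Prop :=
  ∀ z b, z a = true → A z b = 0

/-- A gate that avoids an ancilla leaves it fresh for the later gates that need it. -/
theorem CleanOn.gateOne {w : ℕ} {κ : Type*} {a j : Fin w} {A : Matrix (Reg w) κ ℂ}
    (h : CleanOn a A) (haj : a ≠ j) (U : Matrix.unitaryGroup (Reg 1) ℂ) :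
    CleanOn a ((gateOne j U).toOp * A) := by
  intro z b hz
  rw [gateOne_mul_apply]
  refine Finset.sum_eq_zero fun v _ => ?_
  rw [h, mul_zero]
  rw [extend_of_notMem, hz]
  rintro ⟨i, hi⟩
  exact haj hi.symm

theorem CleanOn.gateSwapUnless {w : ℕ} {κ : Type*} {a' : Fin w} {A : Matrix (Reg w) κ ℂ}
    (h : CleanOn a' A) (p : Bool) {c t a : Fin w} (h₁ : c ≠ t) (h₂ : c ≠ a) (h₃ : t ≠ a)
    (hc : a' ≠ c) (ht : a' ≠ t) (ha : a' ≠ a) :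
    CleanOn a' ((gateSwapUnless p c t a h₁ h₂ h₃).toOp * A) := by
  intro z b hz
  rw [gateSwapUnless_mul_apply, h]
  rw [extend_of_notMem, hz]
  rintro ⟨i, hi⟩
  fin_cases i
  · exact hc hi.symm
  · exact ht hi.symm
  · exact ha hi.symm

/-- If the swap took place, `t` now holds the fresh `|0⟩` and cannot show `1`. Seeing `1` on `t`
thus certifies that the control showed `p`: the gate computes a logical "and" on the target. -/
theorem gateSwapUnless_mul_apply_of_clean {w : ℕ} {κ : Type*} {A : Matrix (Reg w) κ ℂ}
    (p : Bool) {c t a : Fin w} (h₁ : c ≠ t) (h₂ : c ≠ a) (h₃ : t ≠ a) (h : CleanOn a A)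
    {z : Reg w} (hz : z t = true) (b : κ) :
    ((gateSwapUnless p c t a h₁ h₂ h₃).toOp * A) z b = if z c = p then A z b else 0 := by
  rw [gateSwapUnless_mul_apply]
  have h0 : threeWires c t a h₁ h₂ h₃ 0 = c := rfl
  have h1 : threeWires c t a h₁ h₂ h₃ 1 = t := rfl
  have h2 : threeWires c t a h₁ h₂ h₃ 2 = a := rfl
  split_ifs with hc
  · congr 1
    have : (swapUnless p fun i => z (threeWires c t a h₁ h₂ h₃ i)) =
        fun i => z (threeWires c t a h₁ h₂ h₃ i) := by
      simp [swapUnless, h0, hc]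
    rw [this]
    exact extend_comp_self _ _ _ fun _ _ => rfl
  · apply h
    refine (extend_self_apply (threeWires c t a h₁ h₂ h₃) _ z 2).trans ?_
    simp [swapUnless, h0, hc, h1, hz]

/-! ## Kraus form of circuits -/

namespace Circuit

variable {α β A B : Type} {encIn : α → A → Bool} {encOut : β → B → Bool}
  {m : α → ℕ} {m' : β → ℕ}

/-- The amplitudes of the kept wires when the other wires show `z`. -/
def branch (C : Circuit encIn encOut m m') (x : α) (y : β) (z : Reg C.width) :
    Matrix (Reg (m' y)) (Reg (m x)) ℂ :=
  Matrix.of fun b c => C.amp x (Function.extend (C.memOut y) b z) c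

theorem branch_apply (C : Circuit encIn encOut m m') (x : α) (y : β) (z : Reg C.width)
    (b : Reg (m' y)) (c : Reg (m x)) :
    C.branch x y z b c = C.amp x (Function.extend (C.memOut y) b z) c := rfl

/-- The pairs `(z, z')` in the partial trace agree off the kept wires, so they are parametrised by
that common part together with the entries `b`, `b'`. The common part is represented by the label
that shows `true` on all kept wires; the value `true` is an arbitrary filler. The predicate `p` is
left free so that callers can supply a convenient form of it and of its decidability. -/
theorem run_eq_sum (C : Circuit encIn encOut m m') (x : α) (y : β) (ρ : Op (m x))
    (p : Reg C.width → Prop) [DecidablePred p]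
    (hp : ∀ z, p z ↔ (∀ k, z (C.msgOut k) = encOut y k) ∧ ∀ i, z (C.memOut y i) = true) :
    C.run x y ρ = ∑ z : Reg C.width,
      if p z then C.branch x y z * ρ * (C.branch x y z)ᴴ else 0 := by
  classical
  simp only [hp]
  ext b b'
  rw [Matrix.sum_apply, run, Matrix.of_apply, ← Finset.sum_product', ← Finset.sum_filter]
  simp only [apply_ite (fun M : Op (m' y) => M b b'), Matrix.zero_apply]
  rw [← Finset.sum_filter]
  have hmsg : ∀ (v : Reg (m' y)) (z : Reg C.width) k,
      Function.extend (C.memOut y) v z (C.msgOut k) = z (C.msgOut k) := fun v z k =>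
    extend_of_notMem _ _ _ fun ⟨i, hi⟩ => C.disjoint_out y i k hi
  refine Finset.sum_bij' (fun p _ => Function.extend (C.memOut y) (fun _ => true) p.1)
    (fun z _ => (Function.extend (C.memOut y) b z, Function.extend (C.memOut y) b' z))
    ?_ ?_ ?_ ?_ ?_
  · rintro ⟨z, z'⟩ h
    simp only [Finset.mem_filter, Finset.mem_univ, true_and, Finset.mem_product] at h ⊢
    exact ⟨fun k => by rw [hmsg, h.1], fun i => extend_self_apply _ _ _ _⟩
  · intro z h
    simp only [Finset.mem_filter, Finset.mem_univ, true_and, Finset.mem_product] at h ⊢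
    refine ⟨fun k => by rw [hmsg, h.1], fun k => by rw [hmsg, h.1],
      fun i => extend_self_apply _ _ _ _, fun i => extend_self_apply _ _ _ _, fun j hj => ?_⟩
    rw [extend_of_notMem _ _ _ hj, extend_of_notMem _ _ _ hj]
  · rintro ⟨z, z'⟩ h
    simp only [Finset.mem_filter, Finset.mem_univ, true_and, Finset.mem_product] at h
    obtain ⟨-, -, h3, h4, h5⟩ := h
    refine Prod.ext ?_ ?_
    · have := extend_comp_self (C.memOut y) z (Function.extend (C.memOut y) (fun _ => true) z)
        fun j hj => extend_of_notMem _ _ _ hj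
      rwa [funext h3] at this
    · have := extend_comp_self (C.memOut y) z' (Function.extend (C.memOut y) (fun _ => true) z)
        fun j hj => (extend_of_notMem _ _ _ hj).trans (h5 j hj)
      rwa [funext h4] at this
  · intro z h
    simp only [Finset.mem_filter, Finset.mem_univ, true_and] at h
    have := extend_comp_self (C.memOut y) z (Function.extend (C.memOut y) b z)
      fun j hj => extend_of_notMem _ _ _ hj
    rwa [funext h.2] at this
  · rintro ⟨z, z'⟩ h
    simp only [Finset.mem_filter, Finset.mem_univ, true_and, Finset.mem_product] at h
    obtain ⟨-, -, h3, h4, h5⟩ := h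
    have e1 : ∀ c, C.branch x y (Function.extend (C.memOut y) (fun _ => true) z) b c =
        C.amp x z c := by
      intro c
      rw [branch_apply]
      congr 1
      funext j
      by_cases hj : j ∈ Set.range (C.memOut y)
      · obtain ⟨i, rfl⟩ := hj; rw [extend_self_apply, h3]
      · rw [extend_of_notMem _ _ _ hj, extend_of_notMem _ _ _ hj]
    have e2 : ∀ c, C.branch x y (Function.extend (C.memOut y) (fun _ => true) z) b' c =
        C.amp x z' c := by
      intro c
      rw [branch_apply]
      congr 1
      funext j
      by_cases hj : j ∈ Set.range (C.memOut y)
      · obtain ⟨i, rfl⟩ := hj; rw [extend_self_apply, h4]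
      · rw [extend_of_notMem _ _ _ hj, extend_of_notMem _ _ _ hj, h5 j hj]
    change ((C.amp x) * ρ * (C.amp x)ᴴ) z z' = _
    simp only [Matrix.mul_apply, Matrix.conjTranspose_apply, e1, e2]

end Circuit

/-! ## Enlarging the set of wires -/

section Wires

variable (w : ℕ) (H : Type) [Fintype H]

/-- The old wires. -/
def oldWire : Fin w ↪ Fin (Fintype.card (Fin w ⊕ H)) :=
  Function.Embedding.inl.trans (Fintype.equivFin _).toEmbedding

/-- The new wires. -/
def newWire : H ↪ Fin (Fintype.card (Fin w ⊕ H)) :=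
  Function.Embedding.inr.trans (Fintype.equivFin _).toEmbedding

variable {w H}

theorem oldWire_ne_newWire (i : Fin w) (k : H) : oldWire w H i ≠ newWire w H k := by
  simp [oldWire, newWire]

theorem newWire_notMem (k : H) : newWire w H k ∉ Set.range (oldWire w H) := by
  rintro ⟨i, hi⟩; exact oldWire_ne_newWire i k hi

theorem wire_cases (j : Fin (Fintype.card (Fin w ⊕ H))) :
    (∃ i, oldWire w H i = j) ∨ ∃ k, newWire w H k = j := by
  obtain ⟨s, rfl⟩ := (Fintype.equivFin (Fin w ⊕ H)).surjective j
  rcases s with i | k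
  · exact Or.inl ⟨i, rfl⟩
  · exact Or.inr ⟨k, rfl⟩

theorem extend_newWire (v : Reg w) (z : Reg (Fintype.card (Fin w ⊕ H))) (k : H) :
    Function.extend (oldWire w H) v z (newWire w H k) = z (newWire w H k) :=
  extend_of_notMem _ _ _ (newWire_notMem k)

theorem extend_trans_oldWire {a : ℕ} (f : Fin a ↪ Fin w) (v : Reg a)
    (z : Reg (Fintype.card (Fin w ⊕ H))) :
    (fun i => Function.extend (f.trans (oldWire w H)) v z (oldWire w H i)) =
      Function.extend f v fun i => z (oldWire w H i) := by
  funext i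
  by_cases hi : i ∈ Set.range f
  · obtain ⟨k, rfl⟩ := hi
    rw [extend_self_apply f]
    exact extend_self_apply (f.trans (oldWire w H)) v z k
  · rw [extend_of_notMem f _ _ hi, extend_of_notMem]
    rintro ⟨k, hk⟩
    exact hi ⟨k, (oldWire w H).injective hk⟩

theorem extend_trans_newWire {a : ℕ} (f : Fin a ↪ Fin w) (v : Reg a)
    (z : Reg (Fintype.card (Fin w ⊕ H))) (k : H) :
    Function.extend (f.trans (oldWire w H)) v z (newWire w H k) = z (newWire w H k) := by
  apply extend_of_notMem
  rintro ⟨i, hi⟩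
  exact oldWire_ne_newWire _ _ hi

theorem sum_wires {E : Type*} [AddCommMonoid E] (h₀ : H → Bool) (F : Reg w → E)
    [DecidablePred fun z : Reg (Fintype.card (Fin w ⊕ H)) =>
      (fun k => z (newWire w H k)) = h₀] :
    ∑ z : Reg (Fintype.card (Fin w ⊕ H)),
      (if (fun k => z (newWire w H k)) = h₀ then F (fun i => z (oldWire w H i)) else 0) =
    ∑ z, F z := by
  classical
  let e : Reg (Fintype.card (Fin w ⊕ H)) ≃ (Fin w → Bool) × (H → Bool) :=
    ((Fintype.equivFin (Fin w ⊕ H)).symm.arrowCongr (Equiv.refl Bool)).trans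
      (Equiv.sumArrowEquivProdArrow _ _ _)
  have h := e.sum_comp (fun p : (Fin w → Bool) × (H → Bool) => if p.2 = h₀ then F p.1 else 0)
  refine Eq.trans ?_ (h.trans ?_)
  · exact Finset.sum_congr rfl fun z _ => if_congr Iff.rfl rfl rfl
  · rw [Fintype.sum_prod_type]
    simp

-- The new wires carry a fixed classical label that gates on the old wires do not see, so it factors
-- out as an indicator.
open Classical in
theorem embedOp_oldWire_mul_apply {κ : Type*} (M : Op w) (L : Matrix (Reg w) κ ℂ)
    (h₀ : H → Bool) (L' : Matrix (Reg (Fintype.card (Fin w ⊕ H))) κ ℂ)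
    (hL : ∀ z b, L' z b = if (fun k => z (newWire w H k)) = h₀ then
      L (fun i => z (oldWire w H i)) b else 0) (z : Reg (Fintype.card (Fin w ⊕ H))) (b : κ) :
    (embedOp (oldWire w H) M * L') z b =
      if (fun k => z (newWire w H k)) = h₀ then (M * L) (fun i => z (oldWire w H i)) b else 0 := by
  rw [embedOp_mul_apply]
  simp only [hL, extend_newWire, extend_self_apply]
  split_ifs
  · rw [Matrix.mul_apply]
  · simp

end Wires

/-! ## Completely positive maps -/

theorem IsCP.zero {m m' : ℕ} : IsCP (0 : Op m →ₗ[ℂ] Op m') := by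
  intro k M _
  have : ampliate (0 : Op m →ₗ[ℂ] Op m') k M = 0 := by ext; simp [ampliate]
  rw [this]
  exact Matrix.PosSemidef.zero

theorem IsCP.add {m m' : ℕ} {Φ Ψ : Op m →ₗ[ℂ] Op m'} (h : IsCP Φ) (h' : IsCP Ψ) :
    IsCP (Φ + Ψ) := by
  intro k M hM
  have : ampliate (Φ + Ψ) k M = ampliate Φ k M + ampliate Ψ k M := by ext; simp [ampliate]
  rw [this]
  exact (h k M hM).add (h' k M hM)

theorem IsCP.sum {m m' : ℕ} {ι : Type*} (s : Finset ι) {Φ : ι → (Op m →ₗ[ℂ] Op m')}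
    (h : ∀ i ∈ s, IsCP (Φ i)) : IsCP (∑ i ∈ s, Φ i) := by
  classical
  induction s using Finset.induction_on with
  | empty => simpa using IsCP.zero
  | insert a s ha ih =>
    rw [Finset.sum_insert ha]
    exact (h a (Finset.mem_insert_self a s)).add
      (ih fun i hi => h i (Finset.mem_insert_of_mem hi))

theorem IsCP.comp {m m' m'' : ℕ} {Φ : Op m →ₗ[ℂ] Op m'} {Ψ : Op m' →ₗ[ℂ] Op m''}
    (h' : IsCP Ψ) (h : IsCP Φ) : IsCP (Ψ ∘ₗ Φ) :=
  fun k M hM => h' k _ (h k M hM)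

theorem IsCP.id {m : ℕ} : IsCP (LinearMap.id : Op m →ₗ[ℂ] Op m) := fun _ _ hM => hM

theorem IsCP.ite {m m' : ℕ} {Φ Ψ : Op m →ₗ[ℂ] Op m'} (p : Prop) [Decidable p] (h : IsCP Φ)
    (h' : IsCP Ψ) : IsCP (if p then Φ else Ψ) := by
  split_ifs <;> assumption

/-- Complete positivity with a one-dimensional auxiliary system is positivity. -/
theorem IsCP.posSemidef {m m' : ℕ} {Φ : Op m →ₗ[ℂ] Op m'} (h : IsCP Φ) {ρ : Op m}
    (hρ : ρ.PosSemidef) : (Φ ρ).PosSemidef :=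
  (h 1 _ (hρ.submatrix Prod.fst)).submatrix fun i => (i, (0 : Fin 1))

/-- The map `ρ ↦ K ρ K†`. -/
def krausMap {m m' : ℕ} (K : Matrix (Reg m') (Reg m) ℂ) : Op m →ₗ[ℂ] Op m' where
  toFun ρ := K * ρ * Kᴴ
  map_add' ρ ρ' := by rw [Matrix.mul_add, Matrix.add_mul]
  map_smul' c ρ := by simp

theorem krausMap_apply {m m' : ℕ} (K : Matrix (Reg m') (Reg m) ℂ) (ρ : Op m) :
    krausMap K ρ = K * ρ * Kᴴ := rfl

theorem IsCP.krausMap {m m' : ℕ} (K : Matrix (Reg m') (Reg m) ℂ) :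
    IsCP (RemoteState.krausMap K) := by
  intro k M hM
  have h := hM.mul_mul_conjTranspose_same (Matrix.kroneckerMap (· * ·) K (1 : Matrix (Fin k) (Fin k) ℂ))
  convert h using 1
  ext ⟨i, a⟩ ⟨i', a'⟩
  simp only [ampliate, krausMap_apply, Matrix.of_apply, Matrix.mul_apply, Fintype.sum_prod_type,
    Matrix.kroneckerMap_apply, Matrix.conjTranspose_apply, Matrix.one_apply, mul_ite, mul_one,
    mul_zero, ite_mul, zero_mul, apply_ite star, star_zero, Finset.sum_ite_eq, Finset.mem_univ,
    if_true]

/-- The row vector `⟨v|`. -/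
def bra {m : ℕ} (v : Reg m → ℂ) : Matrix (Reg 0) (Reg m) ℂ := Matrix.of fun _ j => star (v j)

/-- The map `ρ ↦ ⟨v|ρ|v⟩`. -/
def expectMap {m : ℕ} (v : Reg m → ℂ) : Op m →ₗ[ℂ] Op 0 := krausMap (bra v)

/-- The trace, as a map to operators on no qubits. -/
def traceMap (m : ℕ) : Op m →ₗ[ℂ] Op 0 := ∑ z : Reg m, expectMap (Pi.single z 1)

theorem trace_expectMap {m : ℕ} (v : Reg m → ℂ) (ρ : Op m) :
    (expectMap v ρ).trace = ∑ j, (∑ i, star (v i) * ρ i j) * v j := by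
  rw [Matrix.trace, Fintype.sum_unique, Matrix.diag_apply, expectMap, krausMap_apply,
    Matrix.mul_apply]
  simp [Matrix.mul_apply, bra]

theorem trace_traceMap {m : ℕ} (ρ : Op m) : (traceMap m ρ).trace = ρ.trace := by
  rw [traceMap, LinearMap.sum_apply, Matrix.trace_sum]
  simp only [trace_expectMap, Pi.single_apply, apply_ite star, star_one, star_zero, ite_mul,
    one_mul, zero_mul, Finset.sum_ite_eq', Finset.mem_univ, if_true, mul_ite, mul_one, mul_zero]
  rfl

theorem IsCP.expectMap {m : ℕ} (v : Reg m → ℂ) : IsCP (RemoteState.expectMap v) :=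
  IsCP.krausMap _

theorem IsCP.traceMap (m : ℕ) : IsCP (RemoteState.traceMap m) :=
  IsCP.sum _ fun _ _ => IsCP.expectMap _

theorem op_zero_ext {M M' : Op 0} (h : M.trace = M'.trace) : M = M' := by
  rw [Matrix.trace, Matrix.trace, Fintype.sum_unique, Fintype.sum_unique] at h
  ext i j
  simp only [Matrix.diag_apply] at h
  convert h

/-! ## Qubit vectors -/

theorem sum_reg_one {E : Type*} [AddCommMonoid E] (f : Reg 1 → E) :
    ∑ z, f z = f (fun _ => false) + f (fun _ => true) := by
  rw [← (Equiv.funUnique (Fin 1) Bool).symm.sum_comp, Fintype.sum_bool, add_comm]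
  rfl

/-- Unit vectors of a qubit. -/
def IsUnitVec (v : Reg 1 → ℂ) : Prop :=
  v (fun _ => false) * star (v fun _ => false) + v (fun _ => true) * star (v fun _ => true) = 1

/-- A unit vector orthogonal to `v`. -/
def orth (v : Reg 1 → ℂ) : Reg 1 → ℂ := fun z =>
  if z 0 then star (v fun _ => false) else -star (v fun _ => true)

/-- The projectors onto `v` and `orth v` sum to the identity, so passing and failing the test
exhaust all cases. -/
theorem trace_expectMap_add_orth {v : Reg 1 → ℂ} (hv : IsUnitVec v) (ρ : Op 1) :
    (expectMap v ρ).trace + (expectMap (orth v) ρ).trace = ρ.trace := by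
  rw [trace_expectMap, trace_expectMap]
  simp only [sum_reg_one, orth, Matrix.trace, Matrix.diag_apply]
  simp only [if_true, Bool.false_eq_true, if_false, star_neg, star_star]
  unfold IsUnitVec at hv
  linear_combination (ρ (fun _ => false) (fun _ => false) + ρ (fun _ => true) fun _ => true) * hv

/-- A unitary with `|v⟩ ↦ |1⟩`. -/
def rotOp (v : Reg 1 → ℂ) : Op 1 := Matrix.of fun z j => star (if z 0 then v j else orth v j)

theorem rotOp_mem_unitaryGroup {v : Reg 1 → ℂ} (hv : IsUnitVec v) :
    rotOp v ∈ Matrix.unitaryGroup (Reg 1) ℂ := by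
  rw [Matrix.mem_unitaryGroup_iff]
  have key : ∀ z, z = (fun _ => false) ∨ z = (fun _ : Fin 1 => true) := by decide
  have hne : (fun _ : Fin 1 => false) ≠ fun _ => true := by decide
  unfold IsUnitVec at hv
  ext z z'
  rw [Matrix.star_eq_conjTranspose, Matrix.mul_apply, sum_reg_one, Matrix.one_apply]
  rcases key z with rfl | rfl <;> rcases key z' with rfl | rfl <;>
    simp only [rotOp, orth, Matrix.of_apply, Matrix.conjTranspose_apply, if_true, if_false,
      Bool.false_eq_true, star_neg, star_star, hne, hne.symm] <;>
    first | linear_combination hv | ring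

/-! ## Tests of a qubit -/

section Check

variable {α γ : Type} {m : α → ℕ}

/-- The branch of `I` with a qubit. -/
def Instrument.qubitMap (I : Instrument α RightOut m RightOut.qubits) (x : α) :
    Op (m x) →ₗ[ℂ] Op 1 := I.map x .qubit

theorem Instrument.tp_qubitMap (I : Instrument α RightOut m RightOut.qubits) (x : α)
    (ρ : Op (m x)) : (I.map x .err ρ).trace + (I.qubitMap x ρ).trace = ρ.trace := by
  rw [← I.tp x ρ, sum_rightOut]
  rfl

theorem Instrument.isCP_qubitMap (I : Instrument α RightOut m RightOut.qubits) (x : α) :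
    IsCP (I.qubitMap x) := I.cp x .qubit

open Classical in
/-- Apply `I`; accept if the classical input satisfies `p`, the outcome of `I` is a qubit and this
qubit passes the test for `|v⟩`. -/
def checkInstrument (I : Instrument α RightOut m RightOut.qubits) (pr : γ → α) (p : γ → Prop)
    {v : Reg 1 → ℂ} (hv : IsUnitVec v) :
    Instrument γ Bool (fun c => m (pr c)) (fun _ => 0) where
  map c b := if b = true then
      if p c then expectMap v ∘ₗ I.qubitMap (pr c) else 0
    else traceMap _ ∘ₗ I.map (pr c) .err +
      if p c then expectMap (orth v) ∘ₗ I.qubitMap (pr c)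
      else traceMap _ ∘ₗ I.qubitMap (pr c)
  cp c b := IsCP.ite _ (IsCP.ite _ ((IsCP.expectMap v).comp (I.isCP_qubitMap _)) IsCP.zero)
    (((IsCP.traceMap _).comp (I.cp _ _)).add
      (IsCP.ite _ ((IsCP.expectMap (orth v)).comp (I.isCP_qubitMap _))
        ((IsCP.traceMap _).comp (I.cp _ _))))
  tp c ρ := by
    rw [← I.tp_qubitMap (pr c) ρ, Fintype.sum_bool]
    by_cases h : p c
    · simp only [h, if_true, Bool.false_eq_true, if_false, LinearMap.add_apply,
        LinearMap.comp_apply, Matrix.trace_add, trace_traceMap]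
      rw [← trace_expectMap_add_orth hv (I.qubitMap (pr c) ρ)]
      ring
    · simp [h, Matrix.trace_add, trace_traceMap]

theorem trace_checkInstrument_true (I : Instrument α RightOut m RightOut.qubits) (pr : γ → α)
    (p : γ → Prop) [DecidablePred p] {v : Reg 1 → ℂ} (hv : IsUnitVec v) (c : γ)
    (ρ : Op (m (pr c))) :
    ((checkInstrument I pr p hv).map c true ρ).trace =
      if p c then (expectMap v (I.qubitMap (pr c) ρ)).trace else 0 := by
  simp only [checkInstrument, if_true]
  split_ifs <;> simp

open Classical in
/-- Apply `I` and choose the outcome `y₀`. -/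
def startInstrument {Y : Type} [Fintype Y] {k : ℕ}
    (I : Instrument Unit Unit (fun _ => 0) (fun _ => k)) (y₀ : Y) :
    Instrument Unit Y (fun _ => 0) (fun _ => k) where
  map x y := if y = y₀ then I.map () () else 0
  cp x y := IsCP.ite _ (I.cp _ _) IsCP.zero
  tp x ρ := by
    rw [← I.tp () ρ, Finset.sum_eq_single y₀]
    · simp
    · intro y _ hy; simp [hy]
    · simp

end Check

/-! ## The circuit of a test -/

namespace Circuit

/-- Stating the condition as an arbitrary equivalent proposition with its own decidability instance
avoids any mismatch with the classical instance in `load`. -/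
theorem load_apply {α β A B : Type} {encIn : α → A → Bool} {encOut : β → B → Bool} {m : α → ℕ}
    {m' : β → ℕ} (C : Circuit encIn encOut m m') (x : α) (z : Reg C.width) (b : Reg (m x))
    (p : Prop) [Decidable p] (h : p ↔ (∀ i, z (C.memIn x i) = b i) ∧
      (∀ a, z (C.msgIn a) = encIn x a) ∧
      (∀ j, j ∉ Set.range (C.memIn x) → j ∉ Set.range C.msgIn → z j = false)) :
    C.load x z b = if p then 1 else 0 := by
  rw [load, Matrix.of_apply]
  exact ite_congr (propext h.symm) (fun _ => rfl) fun _ => rfl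

section Check

variable {α γ A G Y : Type} [Fintype Y] {m : α → ℕ} {encIn : α → A → Bool}

/-- The wire of `C` that carries the output qubit. -/
def qubitWire (C : Circuit encIn (oneHot (α := RightOut)) m RightOut.qubits) : Fin C.width :=
  C.memOut .qubit (0 : Fin 1)

/-- The gates of a test: rotate the qubit on the wire `t`, and exchange it with a fresh `|0⟩` if one
of the wires `c₀`, `c₁`, `c₂` does not show the right value. -/
def testGates {w : ℕ} (U : Matrix.unitaryGroup (Reg 1) ℂ) (t c₀ c₁ c₂ : Fin w) (a : Fin 3 ↪ Fin w)
    (h₀ : c₀ ≠ t) (h₁ : c₁ ≠ t) (h₂ : c₂ ≠ t) (h₀a : ∀ i, c₀ ≠ a i) (h₁a : ∀ i, c₁ ≠ a i)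
    (h₂a : ∀ i, c₂ ≠ a i) (hta : ∀ i, t ≠ a i) : List (Gate w) :=
  [gateOne t U, gateSwapUnless true c₀ t (a 0) h₀ (h₀a 0) (hta 0),
    gateSwapUnless true c₁ t (a 1) h₁ (h₁a 1) (hta 1),
    gateSwapUnless false c₂ t (a 2) h₂ (h₂a 2) (hta 2)]

/-- Gates act on at most three wires, so each swap checks one control and uses an ancilla of its
own. The swaps are peeled off from the last to the first: at each stage the remaining ancillas are
clean and `t` shows `1`, and what is left is the rotation. -/
theorem gateProd_testGates_mul_apply {w : ℕ} {κ : Type*} (U : Matrix.unitaryGroup (Reg 1) ℂ)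
    {t c₀ c₁ c₂ : Fin w} {a : Fin 3 ↪ Fin w}
    (h₀ : c₀ ≠ t) (h₁ : c₁ ≠ t) (h₂ : c₂ ≠ t) (h₀a : ∀ i, c₀ ≠ a i) (h₁a : ∀ i, c₁ ≠ a i)
    (h₂a : ∀ i, c₂ ≠ a i) (hta : ∀ i, t ≠ a i) (M : Matrix (Reg w) κ ℂ)
    (hM : ∀ i, CleanOn (a i) M) {z : Reg w} (hz : z t = true) (b : κ) :
    (gateProd (testGates U t c₀ c₁ c₂ a h₀ h₁ h₂ h₀a h₁a h₂a hta) * M) z b =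
      if z c₀ = true ∧ z c₁ = true ∧ z c₂ = false then
        ∑ v : Reg 1, (U : Op 1) (fun _ => true) v * M (Function.extend (oneWire t) v z) b
      else 0 := by
  have ha : ∀ {i j : Fin 3}, i ≠ j → a i ≠ a j := fun h => a.injective.ne h
  have c1 : ∀ i, CleanOn (a i) ((gateOne t U).toOp * M) := fun i =>
    (hM i).gateOne (hta i).symm U
  have c2 : ∀ i, i ≠ 0 → CleanOn (a i) ((gateSwapUnless true c₀ t (a 0) h₀ (h₀a 0) (hta 0)).toOp *
      ((gateOne t U).toOp * M)) := fun i hi =>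
    (c1 i).gateSwapUnless _ _ _ _ (h₀a i).symm (hta i).symm (ha hi)
  have c3 := (c2 2 (by decide)).gateSwapUnless true h₁ (h₁a 1) (hta 1) (h₁a 2).symm (hta 2).symm
    (ha (by decide))
  simp only [testGates, gateProd_cons, gateProd_nil, Matrix.one_mul, Matrix.mul_assoc]
  rw [gateSwapUnless_mul_apply_of_clean false h₂ (h₂a 2) (hta 2) c3 hz,
    gateSwapUnless_mul_apply_of_clean true h₁ (h₁a 1) (hta 1) (c2 1 (by decide)) hz,
    gateSwapUnless_mul_apply_of_clean true h₀ (h₀a 0) (hta 0) (c1 0) hz, gateOne_mul_apply, hz]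
  by_cases e0 : z c₀ = true <;> by_cases e1 : z c₁ = true <;> by_cases e2 : z c₂ = false <;>
    simp [e0, e1, e2]

theorem qubitWire_ne (C : Circuit encIn (oneHot (α := RightOut)) m RightOut.qubits)
    (r : RightOut) : C.msgOut r ≠ C.qubitWire := fun h => C.disjoint_out .qubit (0 : Fin 1) r h.symm

/-- The three ancillas of a test. -/
def ancilla (w : ℕ) (Y : Type) [Fintype Y] : Fin 3 ↪ Fin (Fintype.card (Fin w ⊕ (Y ⊕ Fin 3))) :=
  Function.Embedding.inr.trans (newWire w (Y ⊕ Fin 3))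

/-- The input wires of a test. -/
def checkWire {w : ℕ} (f : A ↪ Fin w) (e : G ≃ Y ⊕ A) (g : G) :
    Fin (Fintype.card (Fin w ⊕ (Y ⊕ Fin 3))) :=
  Sum.elim (fun y => newWire w (Y ⊕ Fin 3) (.inl y)) (fun i => oldWire w (Y ⊕ Fin 3) (f i)) (e g)

theorem checkWire_injective {w : ℕ} (f : A ↪ Fin w) (e : G ≃ Y ⊕ A) :
    Function.Injective (checkWire f e) := by
  intro g g' h
  apply e.injective
  unfold checkWire at h
  revert h
  rcases e g with y | i <;> rcases e g' with y' | i' <;> intro h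
  · exact congrArg _ (Sum.inl.inj ((newWire _ _).injective h))
  · exact absurd h.symm (oldWire_ne_newWire _ _)
  · exact absurd h (oldWire_ne_newWire _ _)
  · exact congrArg _ (f.injective ((oldWire _ _).injective h))

/-- Run `C` and test the resulting qubit, if there is one and if the additional classical input
equals `y₀`. -/
def check (C : Circuit encIn (oneHot (α := RightOut)) m RightOut.qubits) (pr : γ → α)
    (encγ : γ → G → Bool) (e : G ≃ Y ⊕ A) (y₀ : Y) (U : Matrix.unitaryGroup (Reg 1) ℂ) :
    Circuit encγ encBool (fun c => m (pr c)) (fun _ => 0) where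
  width := Fintype.card (Fin C.width ⊕ (Y ⊕ Fin 3))
  msgIn := ⟨checkWire C.msgIn e, checkWire_injective _ _⟩
  memIn c := (C.memIn (pr c)).trans (oldWire _ _)
  disjoint_in := by
    intro c i g h
    change oldWire _ _ _ = checkWire _ _ _ at h
    unfold checkWire at h
    revert h
    rcases e g with y | j <;> intro h
    · exact oldWire_ne_newWire _ _ h
    · exact C.disjoint_in _ _ _ ((oldWire _ _).injective h)
  gates := C.gates.map (Gate.lift (oldWire _ _)) ++
    testGates U (oldWire C.width (Y ⊕ Fin 3) C.qubitWire) (newWire _ _ (.inl y₀))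
      (oldWire _ _ (C.msgOut .qubit)) (oldWire _ _ (C.msgOut .err)) (ancilla C.width Y)
      (oldWire_ne_newWire _ _).symm ((oldWire _ _).injective.ne (C.qubitWire_ne _))
      ((oldWire _ _).injective.ne (C.qubitWire_ne _))
      (fun _ => (newWire _ _).injective.ne Sum.inl_ne_inr)
      (fun _ => oldWire_ne_newWire _ _) (fun _ => oldWire_ne_newWire _ _)
      (fun _ => oldWire_ne_newWire _ _)
  msgOut := ⟨fun _ => oldWire _ _ C.qubitWire, fun _ _ _ => rfl⟩
  memOut _ := ⟨Fin.elim0, fun i => i.elim0⟩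
  disjoint_out _ i := i.elim0

variable (C : Circuit encIn (oneHot (α := RightOut)) m RightOut.qubits) (pr : γ → α)
    (encγ : γ → G → Bool) (e : G ≃ Y ⊕ A) (y₀ : Y) (U : Matrix.unitaryGroup (Reg 1) ℂ)

theorem size_check : (C.check pr encγ e y₀ U).size ≤ C.size + Fintype.card Y + 7 := by
  have h1 : (C.check pr encγ e y₀ U).width = C.width + (Fintype.card Y + 3) := by
    simp [check]
  have h2 : (C.check pr encγ e y₀ U).gates.length = C.gates.length + 4 := by
    simp [check, testGates]
  unfold size
  omega

-- The added wires start as the one-hot code of the extra letter together with three zeros, and the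
-- old wires start as they do for `C` alone.
open Classical in
theorem load_check (py : γ → Y)
    (henc : ∀ c g, encγ c g = Sum.elim (oneHot (py c)) (encIn (pr c)) (e g)) (c : γ)
    (z : Reg (Fintype.card (Fin C.width ⊕ (Y ⊕ Fin 3)))) (b : Reg (m (pr c))) :
    (C.check pr encγ e y₀ U).load c z b =
      if (fun k => z (newWire _ _ k)) = Sum.elim (oneHot (py c)) (fun _ => false) then
        C.load (pr c) (fun i => z (oldWire _ _ i)) b else 0 := by
  rw [load_apply C _ _ _ _ Iff.rfl, ← ite_and]
  refine load_apply _ _ _ _ _ (Iff.symm ?_)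
  have hin : ∀ g, (C.check pr encγ e y₀ U).msgIn g =
    Sum.elim (fun y => newWire C.width (Y ⊕ Fin 3) (.inl y))
      (fun i => oldWire C.width (Y ⊕ Fin 3) (C.msgIn i)) (e g) := fun _ => rfl
  have hmem : ∀ i, (C.check pr encγ e y₀ U).memIn c i = oldWire _ _ (C.memIn (pr c) i) :=
    fun _ => rfl
  constructor
  · rintro ⟨h1, h2, h3⟩
    refine ⟨funext fun k => ?_, fun i => h1 i, fun i => ?_, fun j hj hj' => h3 _ ?_ ?_⟩
    · rcases k with y | k
      · have := h2 (e.symm (.inl y))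
        rw [hin, henc, e.apply_symm_apply] at this
        exact this
      · refine h3 _ ?_ ?_
        · rintro ⟨i, hi⟩
          exact oldWire_ne_newWire _ _ hi
        · rintro ⟨g, hg⟩
          rw [hin] at hg
          revert hg
          rcases e g with y | i <;> intro hg
          · exact Sum.inl_ne_inr ((newWire _ _).injective hg)
          · exact oldWire_ne_newWire _ _ hg
    · have := h2 (e.symm (.inr i))
      rw [hin, henc, e.apply_symm_apply] at this
      exact this
    · rintro ⟨i, hi⟩
      exact hj ⟨i, (oldWire _ _).injective hi⟩
    · rintro ⟨g, hg⟩
      rw [hin] at hg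
      revert hg
      rcases e g with y | i <;> intro hg
      · exact oldWire_ne_newWire _ _ hg.symm
      · exact hj' ⟨i, (oldWire _ _).injective hg⟩
  · rintro ⟨h0, h1, h2, h3⟩
    refine ⟨h1, fun g => ?_, fun j hj hj' => ?_⟩
    · rw [hin, henc]
      rcases e g with y | i
      · exact congrFun h0 (.inl y)
      · exact h2 i
    · rcases wire_cases j with ⟨i, rfl⟩ | ⟨k, rfl⟩
      · refine h3 i ?_ ?_
        · rintro ⟨i', rfl⟩; exact hj ⟨i', rfl⟩
        · rintro ⟨a, rfl⟩
          refine hj' ⟨e.symm (.inr a), ?_⟩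
          rw [hin, e.apply_symm_apply]; rfl
      · rcases k with y | k
        · refine absurd ⟨e.symm (.inl y), ?_⟩ hj'
          rw [hin, e.apply_symm_apply]; rfl
        · exact congrFun h0 (.inr k)

-- The sum over `v` is the amplitude of the rotated qubit at `1`. The conditions say that the extra
-- letter is `y₀` and that the letter wires of `C` announce a qubit and no error.
open Classical in
theorem amp_check (py : γ → Y)
    (henc : ∀ c g, encγ c g = Sum.elim (oneHot (py c)) (encIn (pr c)) (e g)) (c : γ)
    (z : Reg (Fintype.card (Fin C.width ⊕ (Y ⊕ Fin 3)))) (hz : z (oldWire _ _ C.qubitWire) = true)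
    (b : Reg (m (pr c))) :
    (C.check pr encγ e y₀ U).amp c z b =
      if (fun k => z (newWire _ _ k)) = Sum.elim (oneHot (py c)) (fun _ => false) then
        if py c = y₀ ∧ z (oldWire _ _ (C.msgOut .qubit)) = true ∧
            z (oldWire _ _ (C.msgOut .err)) = false then
          ∑ v : Reg 1, (U : Op 1) (fun _ => true) v *
            C.amp (pr c) (Function.extend (oneWire C.qubitWire) v fun i => z (oldWire _ _ i)) b
        else 0
      else 0 := by
  let L : Matrix (Reg (Fintype.card (Fin C.width ⊕ (Y ⊕ Fin 3)))) (Reg (m (pr c))) ℂ :=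
    (C.check pr encγ e y₀ U).load c
  have hA := embedOp_oldWire_mul_apply (gateProd C.gates) (C.load (pr c))
    (Sum.elim (oneHot (py c)) fun _ => false) L (C.load_check pr encγ e y₀ U py henc c)
  let M : Matrix (Reg (Fintype.card (Fin C.width ⊕ (Y ⊕ Fin 3)))) (Reg (m (pr c))) ℂ :=
    (C.check pr encγ e y₀ U).amp c
  have hU : M = gateProd (C.gates.map (Gate.lift (oldWire C.width (Y ⊕ Fin 3))) ++ _) * L := rfl
  rw [gateProd_append, gateProd_lift, Matrix.mul_assoc] at hU
  refine (congrFun₂ hU z b).trans ?_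
  refine (gateProd_testGates_mul_apply U _ _ _ _ _ _ _ _ ?_ hz b).trans ?_
  -- The ancillas are new wires loaded with `0`, and the gates of `C` do not touch them.
  · intro i z b hz
    refine (hA z b).trans (if_neg fun h => ?_)
    have := congrFun h (.inr i)
    rw [show z (newWire _ _ (.inr i)) = true from hz] at this
    exact Bool.noConfusion this
  · have hx : ∀ v, (embedOp (oldWire C.width (Y ⊕ Fin 3)) (gateProd C.gates) * L)
          (Function.extend (oneWire (oldWire _ _ C.qubitWire)) v z) b =
        if (fun k => z (newWire _ _ k)) = Sum.elim (oneHot (py c)) (fun _ => false) then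
          C.amp (pr c) (Function.extend (oneWire C.qubitWire) v fun i => z (oldWire _ _ i)) b
        else 0 := by
      intro v
      refine (hA _ b).trans ?_
      have h1 := extend_trans_oldWire (H := Y ⊕ Fin 3) (oneWire C.qubitWire) v z
      have h2 := extend_trans_newWire (H := Y ⊕ Fin 3) (oneWire C.qubitWire) v z
      have h3 : (oneWire C.qubitWire).trans (oldWire C.width (Y ⊕ Fin 3)) =
        oneWire (oldWire C.width (Y ⊕ Fin 3) C.qubitWire) := rfl
      rw [h3] at h1 h2
      rw [h1]
      simp only [h2]
      rfl
    simp only [hx]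
    by_cases h : (fun k => z (newWire _ _ k)) = Sum.elim (oneHot (py c)) (fun _ => false)
    -- In the one-hot encoding a single wire decides whether the letter is `y₀`, so one control
    -- suffices.
    · have hy : (z (newWire _ _ (.inl y₀)) = true) ↔ py c = y₀ := by
        have := congrFun h (.inl y₀)
        simp only [Sum.elim_inl, oneHot] at this
        rw [this, decide_eq_true_iff, eq_comm]
      simp only [h, if_true, hy]
    · simp [h]

end Check

end Circuit

/-! ### Acceptance probabilities and correctness of the test circuit -/

namespace Circuit

/-- The number `r ρ r†` for a row vector `r`. -/
def rowSq {m : ℕ} (r : Reg m → ℂ) (ρ : Op m) : ℂ := ∑ j, (∑ i, r i * ρ i j) * star (r j)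

theorem trace_row {m : ℕ} (K : Matrix (Reg 0) (Reg m) ℂ) (ρ : Op m) :
    (K * ρ * Kᴴ).trace = rowSq (K default) ρ := by
  rw [Matrix.trace, Fintype.sum_unique, Matrix.diag_apply, Matrix.mul_apply]
  simp only [Matrix.mul_apply, Matrix.conjTranspose_apply, rowSq]
  congr!

theorem rowSq_zero {m : ℕ} (ρ : Op m) : rowSq (fun _ => 0) ρ = 0 := by simp [rowSq]

/-- No qubits are kept, so every Kraus operator is a single row of the amplitude matrix. -/
theorem trace_run_bit {γ G : Type} {m : γ → ℕ} {encγ : γ → G → Bool}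
    (C : Circuit encγ encBool m (fun _ => 0)) (c : γ) (b : Bool) (ρ : Op (m c)) :
    (C.run c b ρ).trace = ∑ z : Reg C.width,
      if z (C.msgOut ()) = b then rowSq (C.amp c z) ρ else 0 := by
  rw [C.run_eq_sum c b ρ (fun z => z (C.msgOut ()) = b)
    fun z => ⟨fun h => ⟨fun _ => h, fun i => i.elim0⟩, fun h => h.1 ()⟩, Matrix.trace_sum]
  refine Finset.sum_congr rfl fun z _ => ?_
  by_cases hz : z (C.msgOut ()) = b
  · rw [if_pos hz, if_pos hz, trace_row]
    congr 1
    funext j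
    rw [branch_apply]
    congr 1
    funext i
    exact extend_of_notMem _ _ _ fun ⟨k, _⟩ => k.elim0
  · rw [if_neg hz, if_neg hz, Matrix.trace_zero]

theorem trace_run_add {γ G : Type} {m : γ → ℕ} {encγ : γ → G → Bool}
    (C : Circuit encγ encBool m (fun _ => 0)) (c : γ) (ρ : Op (m c)) :
    (C.run c true ρ).trace + (C.run c false ρ).trace = ρ.trace := by
  rw [trace_run_bit, trace_run_bit, ← Finset.sum_add_distrib, ← C.trace_amp c ρ, Matrix.trace]
  refine Finset.sum_congr rfl fun z _ => ?_
  have : (C.amp c * ρ * (C.amp c)ᴴ).diag z = rowSq (C.amp c z) ρ := by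
    simp only [Matrix.diag_apply, Matrix.mul_apply, Matrix.conjTranspose_apply, rowSq]
  rw [this]
  cases z (C.msgOut ()) <;> simp

section Check

variable {α γ A G Y : Type} [Fintype Y] {m : α → ℕ} {encIn : α → A → Bool}

theorem trace_expectMap_kraus {m k : ℕ} (v : Reg k → ℂ) (K : Matrix (Reg k) (Reg m) ℂ) (ρ : Op m) :
    (expectMap v (K * ρ * Kᴴ)).trace = rowSq (fun j => ∑ i, star (v i) * K i j) ρ := by
  rw [expectMap, krausMap_apply]
  have : bra v * (K * ρ * Kᴴ) * (bra v)ᴴ = (bra v * K) * ρ * (bra v * K)ᴴ := by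
    rw [Matrix.conjTranspose_mul]; simp only [Matrix.mul_assoc]
  rw [this, trace_row]
  congr 1

theorem trace_expectMap_run (C : Circuit encIn (oneHot (α := RightOut)) m RightOut.qubits) (x : α)
    (v : Reg 1 → ℂ) (ρ : Op (m x)) :
    (expectMap v (C.run x .qubit ρ : Op 1)).trace = ∑ z : Reg C.width,
      if z (C.msgOut .qubit) = true ∧ z (C.msgOut .err) = false ∧ z C.qubitWire = true then
        rowSq (fun b => ∑ i : Reg 1, star (v i) *
          C.amp x (Function.extend (oneWire C.qubitWire) i z) b) ρ else 0 := by
  have hw : C.memOut .qubit = oneWire C.qubitWire := by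
    ext i
    have : i = (0 : Fin 1) := Subsingleton.elim (α := Fin 1) _ _
    rw [this]; rfl
  let K : Reg C.width → Matrix (Reg 1) (Reg (m x)) ℂ := fun z =>
    Matrix.of fun i b => C.amp x (Function.extend (oneWire C.qubitWire) i z) b
  have hK : ∀ z, C.branch x .qubit z = K z := fun z =>
    congrArg (fun f : Fin 1 ↪ Fin C.width =>
      (Matrix.of fun i b => C.amp x (Function.extend f i z) b : Matrix (Reg 1) (Reg (m x)) ℂ)) hw
  -- The last condition is no measurement of the qubit: it picks the representative used in
  -- `run_eq_sum`. It also matches the accepting value of the output wire of the test circuit, so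
  -- the two sums can be compared term by term.
  let p : Reg C.width → Prop := fun z =>
    z (C.msgOut .qubit) = true ∧ z (C.msgOut .err) = false ∧ z C.qubitWire = true
  have hp : ∀ z, p z ↔ (∀ k, z (C.msgOut k) = oneHot RightOut.qubit k) ∧
      ∀ i : Fin 1, z (C.memOut .qubit i) = true := by
    intro z
    constructor
    · rintro ⟨h1, h2, h3⟩
      refine ⟨fun k => ?_, fun i => ?_⟩
      · cases k
        · rw [h2]; simp [oneHot]
        · rw [h1]; simp [oneHot]
      · rw [Subsingleton.elim i 0]; exact h3
    · rintro ⟨h1, h2⟩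
      refine ⟨(h1 _).trans ?_, (h1 _).trans ?_, h2 0⟩ <;> simp [oneHot]
  have h0 : (C.run x .qubit ρ : Op 1) = ∑ z : Reg C.width,
      if p z then K z * ρ * (K z)ᴴ else 0 := by
    refine (C.run_eq_sum x .qubit ρ p hp).trans ?_
    simp only [hK]
    rfl
  rw [h0, map_sum, Matrix.trace_sum]
  refine Finset.sum_congr rfl fun z _ => ?_
  change (expectMap v (if p z then K z * ρ * (K z)ᴴ else 0)).trace = if p z then _ else _
  split_ifs
  · exact trace_expectMap_kraus v (K z) ρ
  · simp

/-- Only acceptance has to be computed. Outputs on no qubits are determined by their traces, and the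
rejecting one is then forced by trace preservation on both sides. -/
theorem check_implements {C : Circuit encIn (oneHot (α := RightOut)) m RightOut.qubits}
    {I : Instrument α RightOut m RightOut.qubits} (hC : C.Implements I) (pr : γ → α)
    (encγ : γ → G → Bool) (e : G ≃ Y ⊕ A) (y₀ : Y) (py : γ → Y)
    (henc : ∀ c g, encγ c g = Sum.elim (oneHot (py c)) (encIn (pr c)) (e g))
    {v : Reg 1 → ℂ} (hv : IsUnitVec v) :
    (C.check pr encγ e y₀ ⟨rotOp v, rotOp_mem_unitaryGroup hv⟩).Implements
      (checkInstrument I pr (fun c => py c = y₀) hv) := by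
  classical
  set C' := C.check pr encγ e y₀ ⟨rotOp v, rotOp_mem_unitaryGroup hv⟩ with hC'
  have htrue : ∀ c (ρ : Op (m (pr c))),
      ((checkInstrument I pr (fun c => py c = y₀) hv).map c true ρ).trace =
        (C'.run c true ρ).trace := by
    intro c ρ
    rw [trace_checkInstrument_true, trace_run_bit]
    have hq : I.qubitMap (pr c) ρ = C.run (pr c) .qubit ρ := hC _ _ _
    -- The contribution of a label of the old wires; the new wires enter only through the indicator
    -- that `sum_wires` eliminates.
    let F : Reg C.width → ℂ := fun z₁ => if py c = y₀ then
        (if z₁ (C.msgOut .qubit) = true ∧ z₁ (C.msgOut .err) = false ∧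
          z₁ C.qubitWire = true then
          rowSq (fun b => ∑ i : Reg 1, star (v i) *
            C.amp (pr c) (Function.extend (oneWire C.qubitWire) i z₁) b) ρ else 0) else 0
    have hs : (∑ z : Reg C'.width, if z (C'.msgOut ()) = true then rowSq (C'.amp c z) ρ else 0) =
      ∑ z : Reg (Fintype.card (Fin C.width ⊕ (Y ⊕ Fin 3))),
        if (fun k => z (newWire _ _ k)) = Sum.elim (oneHot (py c)) (fun _ => false) then
          F (fun i => z (oldWire _ _ i)) else 0 := by
      refine Finset.sum_congr rfl fun z _ => ?_
      simp only [F]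
      by_cases hz : z (oldWire _ _ C.qubitWire) = true
      · refine (if_pos hz).trans ?_
        rw [show C'.amp c z = _ from funext
          (C.amp_check pr encγ e y₀ ⟨rotOp v, rotOp_mem_unitaryGroup hv⟩ py henc c z hz)]
        by_cases h1 : (fun k => z (newWire _ _ k)) = Sum.elim (oneHot (py c)) (fun _ => false)
        · simp only [h1, if_true, hz, and_true]
          by_cases h2 : py c = y₀
          · simp only [h2, true_and, if_true]
            split_ifs
            · simp only [rotOp, Matrix.of_apply, if_true]
            · exact rowSq_zero ρ
          · simp only [h2, false_and, if_false]
            exact rowSq_zero ρ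
        · simp only [h1, if_false]
          exact rowSq_zero ρ
      · refine (if_neg hz).trans ?_
        simp only [hz, and_false, if_false, ite_self, Bool.false_eq_true]
    refine Eq.trans ?_ (hs.trans (sum_wires _ F)).symm
    simp only [F]
    by_cases h2 : py c = y₀
    · simp only [h2, if_true]
      rw [hq]
      exact C.trace_expectMap_run (pr c) v ρ
    · simp [h2]
  intro c b ρ
  apply op_zero_ext
  cases b
  · have h1 := (checkInstrument I pr (fun c => py c = y₀) hv).tp c ρ
    rw [Fintype.sum_bool, ← C'.trace_run_add c ρ, htrue] at h1
    exact add_left_cancel h1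
  · exact htrue c ρ

end Check

/-! ## The circuit that chooses an input -/

section Start

variable {Y : Type} [Fintype Y] {k : ℕ}

/-- The gate `X`. -/
def notPerm : Equiv.Perm (Reg 1) where
  toFun z := fun i => !z i
  invFun z := fun i => !z i
  left_inv := by decide
  right_inv := by decide

/-- Run `C` and output `y₀` in the one-hot encoding. -/
def choose (C : Circuit encUnit encUnit (fun _ => 0) (fun _ => k)) (y₀ : Y) :
    Circuit encUnit (oneHot (α := Y)) (fun _ => 0) (fun _ => k) where
  width := Fintype.card (Fin C.width ⊕ Y)
  msgIn := ⟨Empty.elim, fun i => i.elim⟩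
  memIn _ := ⟨Fin.elim0, fun i => i.elim0⟩
  disjoint_in _ i := i.elim0
  gates := C.gates.map (Gate.lift (oldWire _ _)) ++
    [gateOne (newWire _ _ y₀) ⟨_, permOp_mem_unitaryGroup notPerm⟩]
  msgOut := newWire _ _
  memOut _ := (C.memOut ()).trans (oldWire _ _)
  disjoint_out _ _ _ := oldWire_ne_newWire _ _

theorem size_choose (C : Circuit encUnit encUnit (fun _ => 0) (fun _ => k)) (y₀ : Y) :
    (C.choose y₀).size = C.size + Fintype.card Y + 1 := by
  have h1 : (C.choose y₀).width = C.width + Fintype.card Y := by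
    simp [choose]
  have h2 : (C.choose y₀).gates.length = C.gates.length + 1 := by
    simp [choose]
  unfold size
  omega

open Classical in
theorem load_choose (C : Circuit encUnit encUnit (fun _ => 0) (fun _ => k)) (y₀ : Y)
    (z : Reg (Fintype.card (Fin C.width ⊕ Y))) (b : Reg 0) :
    (C.choose y₀).load () z b =
      if (fun k => z (newWire _ _ k)) = (fun _ => false) then
        C.load () (fun i => z (oldWire _ _ i)) b else 0 := by
  rw [load_apply C _ _ _ _ Iff.rfl, ← ite_and]
  refine load_apply _ _ _ _ _ (Iff.symm ?_)
  constructor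
  · rintro ⟨h1, h2, h3⟩
    refine ⟨funext fun k => h3 _ (fun ⟨i, _⟩ => i.elim0) (fun ⟨i, _⟩ => i.elim),
      fun i => i.elim0, fun i => i.elim, fun j _ _ => h3 _ (fun ⟨i, _⟩ => i.elim0)
        (fun ⟨i, _⟩ => i.elim)⟩
  · rintro ⟨h0, h1, h2, h3⟩
    refine ⟨fun i => i.elim0, fun i => i.elim, fun j _ _ => ?_⟩
    rcases wire_cases j with ⟨i, rfl⟩ | ⟨i, rfl⟩
    · exact h3 i (fun ⟨i, _⟩ => i.elim0) (fun ⟨i, _⟩ => i.elim)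
    · exact congrFun h0 i

-- The added wires start at zero, and the single NOT gate turns this into the one-hot code of `y₀`.
open Classical in
theorem amp_choose (C : Circuit encUnit encUnit (fun _ => 0) (fun _ => k)) (y₀ : Y)
    (z : Reg (Fintype.card (Fin C.width ⊕ Y))) (b : Reg 0) :
    (C.choose y₀).amp () z b =
      if (fun k => z (newWire _ _ k)) = oneHot y₀ then
        C.amp () (fun i => z (oldWire _ _ i)) b else 0 := by
  let L : Matrix (Reg (Fintype.card (Fin C.width ⊕ Y))) (Reg 0) ℂ := (C.choose y₀).load ()
  have hA := embedOp_oldWire_mul_apply (gateProd C.gates) (C.load ()) (fun _ => false) L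
    (C.load_choose y₀)
  let M : Matrix (Reg (Fintype.card (Fin C.width ⊕ Y))) (Reg 0) ℂ := (C.choose y₀).amp ()
  have hU : M = gateProd (C.gates.map (Gate.lift (oldWire C.width Y)) ++
    [gateOne (newWire _ _ y₀) ⟨_, permOp_mem_unitaryGroup notPerm⟩]) * L := rfl
  rw [gateProd_append, gateProd_lift, Matrix.mul_assoc, gateProd_cons, gateProd_nil,
    Matrix.one_mul] at hU
  refine (congrFun₂ hU z b).trans ?_
  refine (embedOp_permOp_mul_apply (oneWire _) notPerm _ z b).trans ?_
  refine (hA _ b).trans ?_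
  set z' := Function.extend (oneWire (newWire C.width Y y₀))
    (notPerm fun i => z (oneWire (newWire C.width Y y₀) i)) z
  have h1 : (fun i => z' (oldWire C.width Y i)) = fun i => z (oldWire C.width Y i) := by
    funext i
    exact extend_of_notMem _ _ _ fun ⟨_, h⟩ => oldWire_ne_newWire _ _ h.symm
  have h2 : ∀ y, z' (newWire C.width Y y) = if y = y₀ then !z (newWire C.width Y y)
      else z (newWire C.width Y y) := by
    intro y
    split_ifs with h
    · subst h
      exact extend_self_apply (oneWire (newWire C.width Y y)) _ z 0
    · exact extend_of_notMem _ _ _ fun ⟨_, h'⟩ => h ((newWire C.width Y).injective h').symm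
  have h3 : ((fun y => z' (newWire C.width Y y)) = fun _ => false) ↔
      (fun y => z (newWire C.width Y y)) = oneHot y₀ := by
    rw [funext_iff, funext_iff]
    refine forall_congr' fun y => ?_
    rw [h2, oneHot]
    by_cases h : y = y₀ <;> simp [h]
  rw [h1]
  exact if_congr h3 rfl rfl

theorem choose_implements {C : Circuit encUnit encUnit (fun _ => 0) (fun _ => k)}
    {I : Instrument Unit Unit (fun _ => 0) (fun _ => k)} (hC : C.Implements I) (y₀ : Y) :
    (C.choose y₀).Implements (startInstrument I y₀) := by
  classical
  intro x y ρ
  have hbr : ∀ z : Reg (Fintype.card (Fin C.width ⊕ Y)), (C.choose y₀).branch () y z =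
      if (fun k => z (newWire _ _ k)) = oneHot y₀ then
        C.branch () () (fun i => z (oldWire _ _ i)) else 0 := by
    intro z
    ext b c
    refine (C.amp_choose y₀ (Function.extend ((C.memOut ()).trans (oldWire C.width Y)) b z)
      c).trans ?_
    simp only [extend_trans_newWire, extend_trans_oldWire]
    split_ifs <;> rfl
  have hinj : oneHot y = oneHot y₀ ↔ y = y₀ := by
    refine ⟨fun h => ?_, fun h => h ▸ rfl⟩
    have := congrFun h y
    simpa [oneHot] using this
  let p : Reg C.width → Prop := fun z => ∀ i, z (C.memOut () i) = true
  let p' : Reg (Fintype.card (Fin C.width ⊕ Y)) → Prop := fun z =>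
    (fun k => z (newWire C.width Y k)) = oneHot y ∧ p fun i => z (oldWire C.width Y i)
  let F : Reg C.width → Op k := fun z₁ => if y = y₀ then if p z₁ then
    C.branch () () z₁ * ρ * (C.branch () () z₁)ᴴ else 0 else 0
  have hs : (∑ z : Reg (C.choose y₀).width, if p' z then
        (C.choose y₀).branch x y z * ρ * ((C.choose y₀).branch x y z)ᴴ else 0) =
      ∑ z : Reg (Fintype.card (Fin C.width ⊕ Y)),
        if (fun k => z (newWire _ _ k)) = oneHot y₀ then
          F (fun i => z (oldWire _ _ i)) else 0 := by
    refine Finset.sum_congr rfl fun z _ => ?_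
    rw [show (C.choose y₀).branch x y z = _ from hbr z]
    by_cases h1 : (fun k => z (newWire C.width Y k)) = oneHot y₀
    · have h : p' z ↔ y = y₀ ∧ p fun i => z (oldWire C.width Y i) := by
        refine and_congr_left fun _ => ?_
        rw [h1, eq_comm, hinj]
      by_cases h2 : y = y₀ <;> simp [h1, h2, h, F]
    · simp [h1]
  refine Eq.trans ?_ ((C.choose y₀).run_eq_sum x y ρ p'
    fun z => and_congr_left fun _ => funext_iff).symm
  refine Eq.trans ?_ (hs.trans (sum_wires _ F)).symm
  simp only [startInstrument, F]
  by_cases h2 : y = y₀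
  · simp only [h2, if_true]
    exact (hC () () ρ).trans (C.run_eq_sum () () ρ p fun z =>
      ⟨fun h => ⟨fun i => i.elim, h⟩, fun h => h.2⟩)
  · simp [h2]

end Start

end Circuit

/-! ## Identity instruments and circuits -/

/-- Do nothing. -/
def trivialInstrument : Instrument Unit Unit (fun _ => 0) (fun _ => 0) where
  map _ _ := LinearMap.id
  cp _ _ := IsCP.id
  tp _ _ := by simp

/-- The empty circuit. -/
def trivialCircuit : Circuit encUnit encUnit (fun _ => 0) (fun _ => 0) where
  width := 0
  msgIn := ⟨Empty.elim, fun i => i.elim⟩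
  memIn _ := Function.Embedding.refl _
  disjoint_in _ i := i.elim0
  gates := []
  msgOut := ⟨Empty.elim, fun i => i.elim⟩
  memOut _ := Function.Embedding.refl _
  disjoint_out _ i := i.elim0

theorem trivialCircuit_implements : trivialCircuit.Implements trivialInstrument := by
  intro x y ρ
  apply op_zero_ext
  rw [trivialCircuit.run_eq_sum x y ρ (fun _ => True)
    fun z => ⟨fun _ => ⟨fun i => i.elim, fun i => i.elim0⟩, fun _ => trivial⟩]
  change ρ.trace = _
  have h : ∀ z, trivialCircuit.branch x y z = trivialCircuit.amp x := by
    intro z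
    ext b c
    rw [Circuit.branch_apply]
    exact congrArg (fun z' : Reg 0 => trivialCircuit.amp x z' c) (Subsingleton.elim _ _)
  simp only [h, if_true]
  rw [← trivialCircuit.trace_amp x ρ]
  exact (congrArg Matrix.trace (Fintype.sum_unique fun _ : Reg 0 => _)).symm

/-- Pass on the letter and the qubits. -/
def passInstrument : Instrument RightOut RightOut (fun r => 0 + r.qubits) RightOut.qubits where
  map
    | .err, .err => (LinearMap.id : Op 0 →ₗ[ℂ] Op 0)
    | .qubit, .qubit => (LinearMap.id : Op 1 →ₗ[ℂ] Op 1)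
    | .err, .qubit => 0
    | .qubit, .err => 0
  cp
    | .err, .err => IsCP.id
    | .qubit, .qubit => IsCP.id
    | .err, .qubit => IsCP.zero
    | .qubit, .err => IsCP.zero
  tp x ρ := by
    rw [sum_rightOut]
    cases x
    · exact (congrArg (fun c : ℂ => Matrix.trace (ρ : Op 0) + c)
        (Matrix.trace_zero (Reg 1) ℂ)).trans (add_zero _)
    · exact (congrArg (fun c : ℂ => c + Matrix.trace (ρ : Op 1))
        (Matrix.trace_zero (Reg 0) ℂ)).trans (zero_add _)

theorem qubits_le_one (r : RightOut) : r.qubits ≤ 1 := by cases r <;> decide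

theorem eq_of_fin_qubits {r : RightOut} (i j : Fin r.qubits) : i = j := by
  have := qubits_le_one r
  ext; omega

/-- The wire of a letter. -/
def letterWire : RightOut ↪ Fin 3 :=
  ⟨fun r => match r with
    | .err => 0
    | .qubit => 1, by decide⟩

theorem letterWire_ne (r : RightOut) : letterWire r ≠ 2 := by cases r <;> decide

/-- The circuit without gates on the wires of a letter and a qubit. -/
def passCircuit : Circuit (oneHot (α := RightOut)) (oneHot (α := RightOut))
    (fun r => 0 + r.qubits) RightOut.qubits where
  width := 3
  msgIn := letterWire
  memIn r := ⟨fun _ => 2, fun i j _ => by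
    have := qubits_le_one r
    ext; omega⟩
  disjoint_in _ _ r h := letterWire_ne r h.symm
  gates := []
  msgOut := letterWire
  memOut r := ⟨fun _ => 2, fun i j _ => eq_of_fin_qubits i j⟩
  disjoint_out _ _ r h := letterWire_ne r h.symm

open Classical in
theorem passCircuit_amp (x : RightOut) (z : Reg 3) (b : Reg (0 + x.qubits)) :
    passCircuit.amp x z b = if (∀ i, z 2 = b i) ∧ (∀ r, z (letterWire r) = oneHot x r) ∧
      (x = .err → z 2 = false) then 1 else 0 := by
  have h1 : passCircuit.amp x = passCircuit.load x := Matrix.one_mul _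
  rw [h1]
  refine Circuit.load_apply _ _ _ _ _ ?_
  refine and_congr_right fun _ => and_congr_right fun _ => ⟨fun h j hj hj' => ?_, fun h hx => ?_⟩
  · have hj2 : j = (2 : Fin 3) := by
      have e : ∀ j : Fin 3, j = 0 ∨ j = 1 ∨ j = 2 := by decide
      rcases e j with rfl | rfl | rfl
      · exact absurd ⟨.err, rfl⟩ hj'
      · exact absurd ⟨.qubit, rfl⟩ hj'
      · rfl
    cases x
    · rw [hj2]; exact h rfl
    · exact absurd ⟨(0 : Fin 1), hj2.symm⟩ hj
  · subst hx
    refine h (2 : Fin 3) (fun ⟨i, _⟩ => (i : Fin 0).elim0) fun ⟨r, hr⟩ => letterWire_ne r hr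

theorem passCircuit_branch_ne {x y : RightOut} (hxy : x ≠ y) {z : Reg 3}
    (hz : ∀ r, z (letterWire r) = oneHot y r) : passCircuit.branch x y z = 0 := by
  classical
  ext b c
  refine (passCircuit.branch_apply _ _ _ b c).trans ?_
  refine (passCircuit_amp x _ c).trans (if_neg ?_)
  rintro ⟨-, h, -⟩
  have h1 := h x
  have h2 : Function.extend (passCircuit.memOut y) b z (letterWire x) = z (letterWire x) :=
    extend_of_notMem (w := 3) _ _ _ fun ⟨i, hi⟩ => letterWire_ne x hi.symm
  rw [h2, hz] at h1
  simp [oneHot, hxy] at h1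

/-- Without gates the letter wires keep the input letter, so unequal letters give amplitude zero.
For equal letters exactly one environment label contributes, and its Kraus operator is the identity.
-/
theorem passCircuit_implements : passCircuit.Implements passInstrument := by
  classical
  intro x y ρ
  let p : Reg 3 → Prop := fun z =>
    (∀ r, z (letterWire r) = oneHot y r) ∧ ∀ _ : Fin y.qubits, z 2 = true
  refine Eq.trans ?_ (passCircuit.run_eq_sum x y ρ p fun _ => Iff.rfl).symm
  by_cases hxy : x = y
  · subst hxy
    -- The last entry is the filler `true` if wire 2 carries the kept qubit, and the blank value
    -- `false` if there is no qubit.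
    let z₀ : Reg 3 := ![decide (x = .err), decide (x = .qubit), decide (x = .qubit)]
    have hz₀ : ∀ r, z₀ (letterWire r) = oneHot x r := by
      intro r; cases x <;> cases r <;> simp [z₀, letterWire, oneHot]
    have hz₀' : z₀ 2 = decide (x = .qubit) := rfl
    have hp : p z₀ := by
      refine ⟨hz₀, ?_⟩
      cases x
      · exact fun i => i.elim0
      · exact fun _ => rfl
    have hz : ∀ z, p z → z 2 = z₀ 2 → z = z₀ := by
      intro z h h2
      funext j
      have e : ∀ j : Fin 3, j = letterWire .err ∨ j = letterWire .qubit ∨ j = 2 := by decide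
      rcases e j with rfl | rfl | rfl
      · rw [h.1, hz₀]
      · rw [h.1, hz₀]
      · exact h2
    have hs := Finset.sum_eq_single (s := Finset.univ)
      (f := fun z : Reg 3 => if p z then passCircuit.branch x x z * ρ *
        (passCircuit.branch x x z)ᴴ else 0) z₀
      (by
        intro z _ hne
        simp only
        split_ifs with h
        · have : passCircuit.branch x x z = 0 := by
            ext b c
            refine (passCircuit.branch_apply _ _ _ b c).trans ?_
            refine (passCircuit_amp x _ c).trans (if_neg ?_)
            rintro ⟨-, -, h3⟩
            cases x
            · have h2 : Function.extend (passCircuit.memOut .err) b z (2 : Fin 3) = z 2 :=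
                extend_of_notMem (w := 3) _ _ _ fun ⟨i, _⟩ => (i : Fin 0).elim0
              exact hne (hz z h ((h2.symm.trans (h3 rfl)).trans hz₀'.symm))
            · exact hne (hz z h (h.2 (0 : Fin 1)))
          rw [this, Matrix.zero_mul, Matrix.zero_mul]
        · rfl) (by simp)
    refine Eq.trans ?_ hs.symm
    rw [if_pos hp]
    cases x
    · have h1 : passCircuit.branch .err .err z₀ = (1 : Op 0) := by
        ext b c
        refine (passCircuit.branch_apply _ _ _ b c).trans ?_
        refine (passCircuit_amp .err _ c).trans ?_
        have h2 : Function.extend (passCircuit.memOut .err) b z₀ = z₀ := by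
          funext j
          exact extend_of_notMem (w := 3) _ _ _ fun ⟨i, _⟩ => (i : Fin 0).elim0
        rw [h2, if_pos ⟨fun i => (i : Fin 0).elim0, hz₀, fun _ => rfl⟩]
        have : b = c := Subsingleton.elim (α := Reg 0) b c
        rw [this]
        exact (Matrix.one_apply_eq (n := Reg 0) c).symm
      rw [h1]
      have key : ∀ σ : Op 0, σ = (1 : Op 0) * σ * (1 : Op 0)ᴴ := by simp
      exact key ρ
    · have h1 : passCircuit.branch .qubit .qubit z₀ = (1 : Op 1) := by
        ext b c
        refine (passCircuit.branch_apply _ _ _ b c).trans ?_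
        refine (passCircuit_amp .qubit _ c).trans ?_
        have h2 : Function.extend (passCircuit.memOut .qubit) b z₀ (2 : Fin 3) = b (0 : Fin 1) :=
          extend_self_apply (passCircuit.memOut .qubit) b z₀ (0 : Fin 1)
        have h3 : ∀ r, Function.extend (passCircuit.memOut .qubit) b z₀ (letterWire r) =
            oneHot RightOut.qubit r := fun r =>
          (extend_of_notMem (w := 3) _ _ _ fun ⟨i, hi⟩ => letterWire_ne r hi.symm).trans (hz₀ r)
        have hiff : ((∀ i, Function.extend (passCircuit.memOut .qubit) b z₀ (2 : Fin 3) = c i) ∧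
            (∀ r, Function.extend (passCircuit.memOut .qubit) b z₀ (letterWire r) =
              oneHot RightOut.qubit r) ∧
            (RightOut.qubit = .err →
              Function.extend (passCircuit.memOut .qubit) b z₀ (2 : Fin 3) = false)) ↔ b = c := by
          rw [h2]
          constructor
          · rintro ⟨h, -, -⟩
            funext i
            have : i = (0 : Fin 1) := Subsingleton.elim (α := Fin 1) _ _
            rw [this]; exact h (0 : Fin 1)
          · rintro rfl
            refine ⟨fun i => ?_, h3, fun h => by cases h⟩
            have : i = (0 : Fin 1) := Subsingleton.elim (α := Fin 1) _ _
            rw [this]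
        by_cases hbc : b = c
        · refine (if_pos (hiff.2 hbc)).trans ?_
          rw [hbc]
          exact (Matrix.one_apply_eq (n := Reg 1) c).symm
        · exact (if_neg (mt hiff.1 hbc)).trans (Matrix.one_apply_ne (n := Reg 1) hbc).symm
      rw [h1]
      have key : ∀ σ : Op 1, σ = (1 : Op 1) * σ * (1 : Op 1)ᴴ := by simp
      exact key ρ
  · have h0 : passInstrument.map x y = 0 := by
      cases x <;> cases y <;> first | rfl | exact absurd rfl hxy
    rw [h0, LinearMap.zero_apply]
    refine (Finset.sum_eq_zero fun z _ => ?_).symm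
    split_ifs with h
    · rw [passCircuit_branch_ne hxy h.1, Matrix.zero_mul, Matrix.zero_mul]
    · rfl

/-! ## The distinguishers -/

/-- Choose the left input `W`; accept if the left output is `y₀` and the right output is a qubit
that passes the test for `|v⟩`. -/
def outputTest (W : Basis) (y₀ : LeftOut) {v : Reg 1 → ℂ} (hv : IsUnitVec v) :
    OutputDistinguisher RSPV where
  mem := 0
  start := startInstrument trivialInstrument W
  decide := checkInstrument passInstrument (Prod.snd : LeftOut × RightOut → RightOut)
    (fun p => p.1 = y₀) hv

/-- Choose the left input `W`, run the honest server `B`, and accept if the left output is `y₀` and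
the server outputs a qubit that passes the test for `|v⟩`. -/
def channelTest {N ℓ : ℕ} (B : Server RSPV N ℓ) (W : Basis) (y₀ : LeftOut) {v : Reg 1 → ℂ}
    (hv : IsUnitVec v) : ChannelDistinguisher RSPV N ℓ where
  mem := B.mem
  start := startInstrument B.start W
  step := B.step
  decide := checkInstrument B.finish (fun _ : Option LeftOut => ()) (fun o => o = some y₀) hv

theorem outputTest_hasSize (W : Basis) (y₀ : LeftOut) {v : Reg 1 → ℂ} (hv : IsUnitVec v) :
    (outputTest W y₀ hv).HasSize ((trivialCircuit.choose W).size +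
      (passCircuit.size + Fintype.card LeftOut + 7)) :=
  ⟨trivialCircuit.choose W, passCircuit.check (Prod.snd : LeftOut × RightOut → RightOut) oneHot₂
      (Equiv.refl _) y₀ ⟨rotOp v, rotOp_mem_unitaryGroup hv⟩,
    Circuit.choose_implements trivialCircuit_implements W,
    Circuit.check_implements passCircuit_implements _ _ _ y₀ Prod.fst (fun _ _ => rfl) hv,
    Nat.add_le_add_left (Circuit.size_check _ _ _ _ _ _) _⟩

/-- The overhead over the honest server depends only on the fixed alphabets, so polynomial size is
preserved. -/
theorem channelTest_hasSize {N ℓ s : ℕ} {B : Server RSPV N ℓ} (hB : B.HasSize s) (W : Basis)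
    (y₀ : LeftOut) {v : Reg 1 → ℂ} (hv : IsUnitVec v) :
    (channelTest B W y₀ hv).HasSize
      (s + (Fintype.card Basis + Fintype.card (Option LeftOut) + 8)) := by
  obtain ⟨c₀, c, c₁, h₀, h, h₁, hs⟩ := hB
  refine ⟨c₀.choose W, c, c₁.check (fun _ : Option LeftOut => ()) oneHot
    -- The server's last circuit has no classical input, so the input wires of the test encode the
    -- left output alone.
    (Equiv.sumEmpty (Option LeftOut) Empty).symm (some y₀) ⟨rotOp v, rotOp_mem_unitaryGroup hv⟩,
    Circuit.choose_implements h₀ W, h,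
    Circuit.check_implements h₁ _ _ _ _ id (fun _ _ => rfl) hv, ?_⟩
  have h1 := c₀.size_choose W
  have h2 := c₁.size_check (fun _ : Option LeftOut => ()) oneHot
    (Equiv.sumEmpty (Option LeftOut) Empty).symm (some y₀) ⟨rotOp v, rotOp_mem_unitaryGroup hv⟩
  refine le_trans (add_le_add (add_le_add h1.le le_rfl) h2) ?_
  have key : ∀ a b c d e : ℕ, a + b + c ≤ s → a + d + 1 + b + (c + e + 7) ≤ s + (d + e + 8) := by
    intros; omega
  exact key _ _ _ _ _ hs

/-- The number `⟨v|τ|v⟩`. -/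
def expectation (v : Reg 1 → ℂ) (τ : Op 1) : ℂ := (expectMap v τ).trace

theorem expectation_sum_smul {ι : Type*} (s : Finset ι) (v : Reg 1 → ℂ) (c : ι → ℂ)
    (τ : ι → Op 1) :
    expectation v (∑ t ∈ s, c t • τ t) = ∑ t ∈ s, expectation v (τ t) * c t := by
  rw [expectation, map_sum, Matrix.trace_sum]
  refine Finset.sum_congr rfl fun t _ => ?_
  rw [map_smul, Matrix.trace_smul, smul_eq_mul, mul_comm, expectation]

theorem join_one (τ : Op 1) : (join (1 : Op 0) τ : Op (0 + 1)) = τ := by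
  ext z z'
  rw [join, Matrix.of_apply]
  have h1 : ∀ z : Reg 1, (fun i => z (Fin.natAdd 0 i)) = z := by decide
  refine (congrArg₂ (· * ·) (Matrix.one_apply_eq (n := Reg 0) default)
    (congrArg₂ τ (h1 z) (h1 z'))).trans (one_mul _)

theorem accept_outputTest (W : Basis) (y₀ : LeftOut) {v : Reg 1 → ℂ} (hv : IsUnitVec v)
    (τ : Basis → LeftOut → (r : RightOut) → Op r.qubits) :
    (outputTest W y₀ hv).accept τ = (expectation v (τ W y₀ .qubit)).re := by
  classical
  rw [OutputDistinguisher.accept]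
  congr 1
  have h : ∀ x y r, (((outputTest W y₀ hv).decide.map (y, r) true
      (join ((outputTest W y₀ hv).start.map () x 1) (τ x y r))).trace) =
      if x = W then if y = y₀ then
        if r = .qubit then expectation v (τ W y₀ .qubit) else 0 else 0 else 0 := by
    intro x y r
    refine (trace_checkInstrument_true passInstrument (Prod.snd : LeftOut × RightOut → RightOut)
      (fun p => p.1 = y₀) hv (y, r) _).trans ?_
    by_cases hy : y = y₀
    · subst hy
      by_cases hx : x = W
      · subst hx
        have hst : (outputTest x y hv).start.map () x 1 = (1 : Op 0) := by
          simp only [outputTest, startInstrument, trivialInstrument, if_true]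
          rfl
        simp only [if_true, hst]
        cases r
        · have h0 : (expectMap v (0 : Op 1)).trace = 0 := by simp
          exact h0
        · simp only [if_true, expectation]
          exact congrArg (fun M : Op 1 => (expectMap v M).trace) (join_one _)
      · have hst : (outputTest W y hv).start.map () x 1 = (0 : Op 0) := by
          simp only [outputTest, startInstrument, hx, if_false]
          rfl
        have hj : (join (0 : Op 0) (τ x y r)) = 0 := by ext; simp [join]
        simp only [if_true, hst, hx, if_false]
        refine (congrArg (fun M => (expectMap v (passInstrument.qubitMap r M)).trace) hj).trans ?_
        simp
    · simp [hy]
  change ∑ x : Basis, ∑ y : LeftOut, ∑ r : RightOut, _ = _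
  simp only [h]
  simp

theorem state_channelTest {N ℓ : ℕ} (B : Server RSPV N ℓ) (W : Basis) (y₀ : LeftOut)
    {v : Reg 1 → ℂ} (hv : IsUnitVec v) (x : Basis) (t : Transcript N ℓ) (i : ℕ) :
    (channelTest B W y₀ hv).state x t i = if x = W then B.state t i else 0 := by
  classical
  induction i with
  | zero =>
    change (startInstrument B.start W).map () x 1 = if x = W then B.start.map () () 1 else 0
    simp only [startInstrument]
    split_ifs <;> rfl
  | succ i ih =>
    change (B.step i).map (t.down i) (t.up i) ((channelTest B W y₀ hv).state x t i) =
      if x = W then (B.step i).map (t.down i) (t.up i) (B.state t i) else 0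
    rw [ih]
    split_ifs
    · rfl
    · exact map_zero _

theorem accept_channelTest {N ℓ : ℕ} (B : Server RSPV N ℓ) (W : Basis) (y₀ : LeftOut)
    {v : Reg 1 → ℂ} (hv : IsUnitVec v) (p : Basis → Transcript N ℓ → Option LeftOut → ℂ) :
    (channelTest B W y₀ hv).accept p =
      (∑ t, expectation v (B.output t .qubit) * p W t (some y₀)).re := by
  classical
  rw [ChannelDistinguisher.accept]
  congr 1
  have h : ∀ x t o, ((channelTest B W y₀ hv).decide.map o true
      ((channelTest B W y₀ hv).state x t N)).trace * p x t o =
      if x = W then if o = some y₀ then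
        expectation v (B.output t .qubit) * p W t (some y₀) else 0 else 0 := by
    intro x t o
    have h1 := trace_checkInstrument_true B.finish (fun _ : Option LeftOut => ())
      (fun o => o = some y₀) hv o ((channelTest B W y₀ hv).state x t N)
    refine (congrArg (· * p x t o) h1).trans ?_
    rw [state_channelTest]
    by_cases hx : x = W
    · subst hx
      by_cases ho : o = some y₀
      · subst ho
        simp only [if_true]
        rfl
      · simp [ho]
    · simp [hx]
  change ∑ x : Basis, ∑ t : Transcript N ℓ, ∑ o : Option LeftOut, _ = _
  simp only [h]
  simp

/-- This joins security to availability: playing the honest server on the open channel and then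
testing is the honest protocol followed by the test. -/
theorem accept_honestRun {N ℓ : ℕ} (A : Client RSPV N ℓ) (B : Server RSPV N ℓ) (W : Basis)
    (y₀ : LeftOut) {v : Reg 1 → ℂ} (hv : IsUnitVec v) :
    (channelTest B W y₀ hv).accept (clientSystem A) =
      (outputTest W y₀ hv).accept (honestRun A B) := by
  rw [accept_channelTest, accept_outputTest]
  congr 1
  exact (expectation_sum_smul Finset.univ v (fun t => A.weight W t y₀)
    fun t => B.output t .qubit).symm

/-! ## Positivity of the two sides, given the transcript -/

theorem join_posSemidef {a b : ℕ} {A : Op a} {B : Op b} (hA : A.PosSemidef) (hB : B.PosSemidef) :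
    (join A B).PosSemidef :=
  (hA.kronecker hB).submatrix fun z : Reg (a + b) =>
    ((fun i => z (Fin.castAdd b i), fun i => z (Fin.natAdd a i)) : Reg a × Reg b)

/-- `B ↦ A ⊗ B`. -/
def joinLeft {a : ℕ} (A : Op a) (b : ℕ) : Op b →ₗ[ℂ] Op (a + b) where
  toFun B := join A B
  map_add' B B' := by ext; simp [join, mul_add]
  map_smul' c B := by ext; simp [join, mul_left_comm]

/-- `A ↦ A ⊗ B`. -/
def joinRight (a : ℕ) {b : ℕ} (B : Op b) : Op a →ₗ[ℂ] Op (a + b) where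
  toFun A := join A B
  map_add' A A' := by ext; simp [join, add_mul]
  map_smul' c A := by ext; simp [join, mul_assoc]

theorem Server.state_posSemidef {N ℓ : ℕ} (B : Server RSPV N ℓ) (t : Transcript N ℓ) (i : ℕ) :
    (B.state t i).PosSemidef := by
  induction i with
  | zero => exact (B.start.cp () ()).posSemidef Matrix.PosSemidef.one
  | succ i ih => exact ((B.step i).cp _ _).posSemidef ih

theorem Server.output_posSemidef {N ℓ : ℕ} (B : Server RSPV N ℓ) (t : Transcript N ℓ)
    (r : RightOut) : (B.output t r).PosSemidef :=
  (B.finish.cp _ _).posSemidef (B.state_posSemidef t N)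

theorem sum_option_rightOut {E : Type*} [AddCommMonoid E] (f : Option RightOut → E) :
    ∑ r, f r = f none + (f (some .err) + f (some .qubit)) := by
  rw [Fintype.sum_option]
  congr 1
  have h : (Finset.univ : Finset RightOut) = {.err, .qubit} := rfl
  rw [h, Finset.sum_pair (by decide)]

theorem rspVOut_err {W : Basis} {c : Bool} {y : LeftOut} (hy : y ≠ .err) :
    rspVOut W c y .err = 0 := by
  cases y
  · exact absurd rfl hy
  · rfl
  · rfl

theorem rspVOut_true {W : Basis} {y : LeftOut} (hy : y ≠ .err) (r : RightOut) :
    rspVOut W true y r = 0 := by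
  cases y <;> cases r <;> first | exact absurd rfl hy | rfl

/-- The qubit that `RSP_V` outputs jointly with the left output `y`. -/
def rspVQubit (W : Basis) (y : LeftOut) : Op 1 := rspVOut W false y .qubit

theorem join_zero {a b : ℕ} (A : Op a) : join A (0 : Op b) = 0 := by ext; simp [join]

/-! ### The simulator's weight as a positive functional of the qubit -/

namespace Simulator

variable {N ℓ : ℕ} (σ : Simulator RSPV N ℓ)

theorem afterAsk_some_err {x : Basis} {y : LeftOut} (hy : y ≠ .err) (i : ℕ)
    (ρ : Option LeftOut → Op (σ.pre i)) : σ.afterAsk x i ρ (some y) (some .err) = 0 := by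
  change ∑ c : Bool, join ((σ.ask i).map () (some c) (ρ none)) (rspVOut x c y .err) = 0
  refine Finset.sum_eq_zero fun c _ => ?_
  rw [rspVOut_err hy, join_zero]

/-- Ask and ignore the answer. -/
def askAny (i : ℕ) : Op (σ.pre i) →ₗ[ℂ] Op (σ.mid i) := ∑ o : Option Bool, (σ.ask i).map () o

theorem isCP_askAny (i : ℕ) : IsCP (σ.askAny i) := IsCP.sum _ fun o _ => (σ.ask i).cp () o

/-- The memory after asking, if the resource was triggered before. -/
def oldAnswer (i : ℕ) (Φ : Op 1 →ₗ[ℂ] Op (σ.pre i)) : Op 1 →ₗ[ℂ] Op (σ.mid i + 0) :=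
  joinRight _ (1 : Op 0) ∘ₗ σ.askAny i ∘ₗ Φ

/-- The memory and the qubit after asking, if the resource is triggered now. -/
def newAnswer (i : ℕ) (ρ : Op (σ.pre i)) : Op 1 →ₗ[ℂ] Op (σ.mid i + 1) :=
  joinLeft ((σ.ask i).map () (some false) ρ) 1

theorem oldAnswer_posSemidef (i : ℕ) {Φ : Op 1 →ₗ[ℂ] Op (σ.pre i)} {ω : Op 1}
    (h : (Φ ω).PosSemidef) : (σ.oldAnswer i Φ ω).PosSemidef :=
  join_posSemidef ((σ.isCP_askAny i).posSemidef h) Matrix.PosSemidef.one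

theorem newAnswer_posSemidef (i : ℕ) {ρ : Op (σ.pre i)} (hρ : ρ.PosSemidef) {ω : Op 1}
    (h : ω.PosSemidef) : (σ.newAnswer i ρ ω).PosSemidef :=
  join_posSemidef (((σ.ask i).cp _ _).posSemidef hρ) h

theorem afterAsk_some_qubit {x : Basis} {y : LeftOut} (hy : y ≠ .err) (i : ℕ)
    (ρ : Option LeftOut → Op (σ.pre i)) : (σ.afterAsk x i ρ (some y) (some .qubit) :
      Op (σ.mid i + 1)) = σ.newAnswer i (ρ none) (rspVQubit x y) := by
  change ∑ c : Bool, join ((σ.ask i).map () (some c) (ρ none)) (rspVOut x c y .qubit) = _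
  rw [Fintype.sum_bool, rspVOut_true hy, join_zero, zero_add]
  rfl

theorem afterAsk_some_none {x : Basis} {y : LeftOut} (i : ℕ)
    (ρ : Option LeftOut → Op (σ.pre i)) : (σ.afterAsk x i ρ (some y) none : Op (σ.mid i + 0)) =
      join (σ.askAny i (ρ (some y))) (1 : Op 0) := by
  rw [askAny, LinearMap.sum_apply]
  rfl

/-- Before the resource is triggered nothing depends on the left input. Afterwards the input and the
left output enter only through the emitted qubit, linearly, because a left output other than `ERR`
forces `c = 0` and a qubit on the right. The induction carries both parts, since the trigger may
occur in any round. -/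
theorem exists_state_eq (t : Transcript N ℓ) (i : ℕ) :
    ∃ (ρ : Op (σ.pre i)) (Φ : Op 1 →ₗ[ℂ] Op (σ.pre i)), ρ.PosSemidef ∧
      (∀ ω : Op 1, ω.PosSemidef → (Φ ω).PosSemidef) ∧ (∀ x, σ.state x t i none = ρ) ∧
      ∀ x y, y ≠ .err → σ.state x t i (some y) = Φ (rspVQubit x y) := by
  induction i with
  | zero =>
    exact ⟨σ.start.map () () 1, 0, (σ.start.cp () ()).posSemidef Matrix.PosSemidef.one,
      fun _ _ => Matrix.PosSemidef.zero, fun _ => rfl, fun _ _ _ => rfl⟩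
  | succ i ih =>
    obtain ⟨ρ, Φ, hρ, hΦ, h1, h2⟩ := ih
    let sa : Op (σ.mid i + 0) →ₗ[ℂ] Op (σ.post i) := (σ.send i).map none (t.down i)
    let sb : Op (σ.mid i + 1) →ₗ[ℂ] Op (σ.post i) := (σ.send i).map (some .qubit) (t.down i)
    refine ⟨(σ.recv i).map (t.up i) () (sa (join ((σ.ask i).map () none ρ) (1 : Op 0))),
      -- The two summands are the cases of a trigger in an earlier round and in the present one.
      (σ.recv i).map (t.up i) () ∘ₗ (sa ∘ₗ σ.oldAnswer i Φ + sb ∘ₗ σ.newAnswer i ρ),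
      ?_, ?_, ?_, ?_⟩
    · exact ((σ.recv i).cp _ _).posSemidef (((σ.send i).cp _ _).posSemidef
        (join_posSemidef (((σ.ask i).cp _ _).posSemidef hρ) Matrix.PosSemidef.one))
    · intro ω hω
      refine ((σ.recv i).cp _ _).posSemidef (Matrix.PosSemidef.add ?_ ?_)
      · exact ((σ.send i).cp none _).posSemidef (σ.oldAnswer_posSemidef i (hΦ ω hω))
      · exact ((σ.send i).cp (some .qubit) _).posSemidef (σ.newAnswer_posSemidef i hρ hω)
    · intro x
      change (σ.recv i).map (t.up i) () (∑ r : Option RightOut, (σ.send i).map r (t.down i)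
        (σ.afterAsk x i (σ.state x t i) none r)) = _
      refine congrArg ((σ.recv i).map (t.up i) ()) ?_
      have e : ∀ r, (σ.send i).map (some r) (t.down i)
        (σ.afterAsk x i (σ.state x t i) none (some r)) = 0 := fun r => map_zero _
      refine (sum_option_rightOut _).trans ?_
      rw [e, e, add_zero, add_zero, ← h1 x]
      rfl
    · intro x y hy
      change (σ.recv i).map (t.up i) () (∑ r : Option RightOut, (σ.send i).map r (t.down i)
        (σ.afterAsk x i (σ.state x t i) (some y) r)) =
        (σ.recv i).map (t.up i) () (sa (σ.oldAnswer i Φ (rspVQubit x y)) +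
          sb (σ.newAnswer i ρ (rspVQubit x y)))
      refine congrArg ((σ.recv i).map (t.up i) ()) ?_
      refine (sum_option_rightOut _).trans ?_
      have e1 : (σ.send i).map (some .err) (t.down i)
          (σ.afterAsk x i (σ.state x t i) (some y) (some .err)) = 0 := by
        rw [σ.afterAsk_some_err hy]; exact map_zero _
      rw [e1, zero_add]
      refine congrArg₂ (· + ·) (congrArg sa ?_) (congrArg sb ?_)
      · refine (σ.afterAsk_some_none i _).trans ?_
        rw [h2 x y hy]
        rfl
      · refine (σ.afterAsk_some_qubit hy i _).trans ?_
        rw [h1 x]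

/-- This is the "measure" half of the hybrid: for a fixed transcript the simulator acts as one
effect on the qubit. The final opportunity to trigger the resource, after the last round, is
included. -/
theorem exists_weight_eq (t : Transcript N ℓ) :
    ∃ F : Op 1 →ₗ[ℂ] ℂ, (∀ ω : Op 1, ω.PosSemidef → 0 ≤ F ω) ∧
      ∀ x y, y ≠ .err → σ.weight x t (some y) = F (rspVQubit x y) := by
  obtain ⟨ρ, Φ, hρ, hΦ, h1, h2⟩ := σ.exists_state_eq t N
  refine ⟨Matrix.traceLinearMap _ ℂ ℂ ∘ₗ σ.oldAnswer N Φ +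
    Matrix.traceLinearMap _ ℂ ℂ ∘ₗ σ.newAnswer N ρ, fun ω hω => ?_, fun x y hy => ?_⟩
  · exact add_nonneg (σ.oldAnswer_posSemidef N (hΦ ω hω)).trace_nonneg
      (σ.newAnswer_posSemidef N hρ hω).trace_nonneg
  · change ∑ r : Option RightOut, (σ.afterAsk x N (σ.state x t N) (some y) r).trace =
      (σ.oldAnswer N Φ (rspVQubit x y)).trace + (σ.newAnswer N ρ (rspVQubit x y)).trace
    refine (sum_option_rightOut _).trans ?_
    have e1 : (σ.afterAsk x N (σ.state x t N) (some y) (some .err)).trace = 0 := by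
      rw [σ.afterAsk_some_err hy]; exact Matrix.trace_zero _ _
    rw [e1, zero_add]
    refine congrArg₂ (· + ·) (congrArg Matrix.trace ?_) (congrArg Matrix.trace ?_)
    · refine (σ.afterAsk_some_none N _).trans ?_
      rw [h2 x y hy]
      rfl
    · refine (σ.afterAsk_some_qubit hy N _).trans ?_
      rw [h1 x]

end Simulator

/-! ## Measure-and-prepare strategies for the four test states -/

/-- The test states: `|0⟩`, `|1⟩` and `|+⟩`, `|-⟩`. -/
def testVec (B s : Bool) : Reg 1 → ℂ :=
  if B then ketPlus (if s then Real.pi else 0) else ketBit s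

theorem ketPlus_testVec (s : Bool) (z : Reg 1) :
    testVec true s z = ((1 / Real.sqrt 2 : ℝ) : ℂ) * if z 0 then (if s then -1 else 1) else 1 := by
  cases s
  · simp [testVec, ketPlus]
  · simp [testVec, ketPlus, mul_comm Complex.I, Complex.exp_pi_mul_I]

theorem inv_sqrt_two_mul_self :
    ((1 / Real.sqrt 2 : ℝ) : ℂ) * ((1 / Real.sqrt 2 : ℝ) : ℂ) = 1 / 2 := by
  rw [← Complex.ofReal_mul, div_mul_div_comm, Real.mul_self_sqrt (by norm_num)]
  norm_num

theorem isUnitVec_testVec (B s : Bool) : IsUnitVec (testVec B s) := by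
  unfold IsUnitVec
  rw [← trace_proj]
  cases B
  · exact trace_ketBit s
  · exact trace_ketPlus _

theorem proj_testVec_true_apply (s : Bool) (z z' : Reg 1) :
    proj (testVec true s) z z' = 1 / 2 * if z 0 = z' 0 then 1 else if s then -1 else 1 := by
  have h : star (((1 / Real.sqrt 2 : ℝ) : ℂ)) = ((1 / Real.sqrt 2 : ℝ) : ℂ) :=
    Complex.conj_ofReal _
  rw [proj, Matrix.vecMulVec_apply, Pi.star_apply, ketPlus_testVec, ketPlus_testVec, star_mul', h,
    mul_mul_mul_comm, inv_sqrt_two_mul_self]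
  congr 1
  cases s <;> cases z 0 <;> cases z' 0 <;> simp

theorem proj_testVec_false_apply (s : Bool) (z z' : Reg 1) :
    proj (testVec false s) z z' = if z 0 = s ∧ z' 0 = s then 1 else 0 := by
  rw [proj, Matrix.vecMulVec_apply, Pi.star_apply]
  simp only [testVec, ketBit, Bool.false_eq_true, if_false]
  cases s <;> cases z 0 <;> cases z' 0 <;> simp

/-- A vector with real amplitudes. -/
def realVec (c s : ℝ) : Reg 1 → ℂ := fun z => if z 0 then (s : ℂ) else (c : ℂ)

/-- Projectors onto real vectors lie in the span of the four test projectors, so positivity there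
constrains the four test values alone. -/
theorem proj_realVec (c s : ℝ) : proj (realVec c s) =
    ((c ^ 2 : ℝ) : ℂ) • proj (testVec false false) + ((s ^ 2 : ℝ) : ℂ) • proj (testVec false true) +
      ((c * s : ℝ) : ℂ) • (proj (testVec true false) - proj (testVec true true)) := by
  ext z z'
  simp only [Matrix.add_apply, Matrix.smul_apply, Matrix.sub_apply, proj_testVec_true_apply,
    proj_testVec_false_apply, smul_eq_mul]
  rw [proj, Matrix.vecMulVec_apply, Pi.star_apply]
  simp only [realVec]
  cases z 0 <;> cases z' 0 <;> simp <;> ring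

theorem proj_testVec_sum : proj (testVec true false) + proj (testVec true true) =
    proj (testVec false false) + proj (testVec false true) := by
  ext z z'
  simp only [Matrix.add_apply, proj_testVec_true_apply, proj_testVec_false_apply]
  cases z 0 <;> cases z' 0 <;> simp <;> norm_num

/-! ### The Bloch disc and the measure-and-prepare bound -/

section Positive

variable (F : Op 1 →ₗ[ℂ] ℂ)

theorem re_testVec_sum : (F (proj (testVec true false))).re + (F (proj (testVec true true))).re =
    (F (proj (testVec false false))).re + (F (proj (testVec false true))).re := by
  rw [← Complex.add_re, ← Complex.add_re, ← map_add, ← map_add, proj_testVec_sum]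

/-- The functional is nonnegative on the real vectors (c, 1), which makes a quadratic polynomial in
c nonnegative. Its discriminant inequality is the claim: the X and Z Bloch components have length at
most the trace. -/
theorem bloch_le (hF : ∀ v, 0 ≤ F (proj v)) :
    ((F (proj (testVec false false))).re - (F (proj (testVec false true))).re) ^ 2 +
      ((F (proj (testVec true false))).re - (F (proj (testVec true true))).re) ^ 2 ≤
    ((F (proj (testVec false false))).re + (F (proj (testVec false true))).re) ^ 2 := by
  have h : ∀ c : ℝ, 0 ≤ (F (proj (testVec false false))).re * (c * c) +
      ((F (proj (testVec true false))).re - (F (proj (testVec true true))).re) * c +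
        (F (proj (testVec false true))).re := by
    intro c
    have h1 := (Complex.le_def.1 (hF (realVec c 1))).1
    rw [proj_realVec, map_add, map_add, map_smul, map_smul, map_smul, map_sub] at h1
    simp only [smul_eq_mul, Complex.add_re, Complex.re_ofReal_mul, Complex.sub_re,
      Complex.zero_re] at h1
    linarith
  have h2 := discrim_le_zero h
  unfold discrim at h2
  linarith

/-- Let P be the product of the two traces and I the inner product of the two Bloch vectors in the
X–Z plane. The left sum is P + I/2 and the sum on the right is P - I/2, while I ≤ P; hence 3P/2
against P/2. -/
theorem measure_and_prepare_le (G : Op 1 →ₗ[ℂ] ℂ) (hF : ∀ v, 0 ≤ F (proj v))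
    (hG : ∀ v, 0 ≤ G (proj v)) :
    ∑ B : Bool, ∑ s : Bool, (G (proj (testVec B s))).re * (F (proj (testVec B s))).re ≤
      3 * ∑ B : Bool, ∑ s : Bool, (G (proj (testVec B (!s)))).re * (F (proj (testVec B s))).re := by
  have h1 := bloch_le F hF
  have h2 := bloch_le G hG
  have e1 := re_testVec_sum F
  have e2 := re_testVec_sum G
  have p : ∀ (H : Op 1 →ₗ[ℂ] ℂ), (∀ v, 0 ≤ H (proj v)) → ∀ B s, 0 ≤ (H (proj (testVec B s))).re :=
    fun H hH B s => (Complex.le_def.1 (hH _)).1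
  have p1 := p F hF false false
  have p2 := p F hF false true
  have q1 := p G hG false false
  have q2 := p G hG false true
  simp only [Fintype.sum_bool, Bool.not_true, Bool.not_false]
  generalize (F (proj (testVec false false))).re = a at *
  generalize (F (proj (testVec false true))).re = b at *
  generalize (F (proj (testVec true false))).re = c at *
  generalize (F (proj (testVec true true))).re = d at *
  generalize (G (proj (testVec false false))).re = a' at *
  generalize (G (proj (testVec false true))).re = b' at *
  generalize (G (proj (testVec true false))).re = c' at *
  generalize (G (proj (testVec true true))).re = d' at *
  -- Cauchy–Schwarz for the two Bloch vectors, each bounded by `bloch_le`.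
  have hcs : ((a - b) * (a' - b') + (c - d) * (c' - d')) ≤ (a + b) * (a' + b') := by
    apply le_of_sq_le_sq _ (by positivity)
    calc ((a - b) * (a' - b') + (c - d) * (c' - d')) ^ 2
        ≤ ((a - b) ^ 2 + (c - d) ^ 2) * ((a' - b') ^ 2 + (c' - d') ^ 2) := by
          nlinarith [sq_nonneg ((a - b) * (c' - d') - (c - d) * (a' - b'))]
      _ ≤ (a + b) ^ 2 * (a' + b') ^ 2 := by gcongr
      _ = ((a + b) * (a' + b')) ^ 2 := by ring
  have hprod : (c + d) * (c' + d') = (a + b) * (a' + b') := by rw [e1, e2]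
  nlinarith [hcs, hprod]

end Positive

/-! ## The tests of a protocol -/

/-- The basis of a test. -/
def testBasis (b : Bool) : Basis := if b then .X else .Z

/-- The left output that belongs to a test state. -/
def testLabel (b s : Bool) : LeftOut := if b then .angle (if s then 4 else 0) else .bit s

/-- The probability of this left output. -/
def testProb (b : Bool) : ℝ := if b then 1 / 8 else 1 / 2

theorem testLabel_ne_err (b s : Bool) : testLabel b s ≠ .err := by
  cases b <;> cases s <;> decide

theorem rspVQubit_test (b s : Bool) :
    rspVQubit (testBasis b) (testLabel b s) = ((testProb b : ℝ) : ℂ) • proj (testVec b s) := by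
  cases b
  · simp [rspVQubit, testBasis, testLabel, testProb, testVec, rspVOut]
  · have h : (4 : ℝ) * (Real.pi / 4) = Real.pi := by ring
    cases s <;> simp [rspVQubit, testBasis, testLabel, testProb, testVec, rspVOut, h]

theorem expectation_eq_trace (v : Reg 1 → ℂ) (τ : Op 1) :
    expectation v τ = (τ * proj v).trace := by
  rw [expectation, trace_expectMap, Matrix.trace]
  simp only [Matrix.diag_apply, Matrix.mul_apply, proj, Matrix.vecMulVec_apply, Pi.star_apply]
  rw [Finset.sum_comm']
  · refine Finset.sum_congr rfl fun j _ => ?_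
    rw [Finset.sum_mul]
    exact Finset.sum_congr rfl fun i _ => by ring
  · simp

theorem expectation_nonneg (v : Reg 1 → ℂ) {τ : Op 1} (hτ : τ.PosSemidef) :
    0 ≤ expectation v τ := ((IsCP.expectMap v).posSemidef hτ).trace_nonneg

theorem expectation_testVec (b s s' : Bool) :
    expectation (testVec b s') (proj (testVec b s)) = if s' = s then 1 else 0 := by
  rw [expectation_eq_trace, Matrix.trace]
  simp only [Matrix.diag_apply, Matrix.mul_apply, sum_reg_one]
  cases b
  · simp only [proj_testVec_false_apply]
    cases s <;> cases s' <;> simp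
  · simp only [proj_testVec_true_apply]
    cases s <;> cases s' <;> norm_num

/-- The bit `f` selects the test: `false` for the emitted state, `true` for the orthogonal one. -/
theorem expectation_rspVQubit (b s f : Bool) :
    expectation (testVec b (s ^^ f)) (rspVQubit (testBasis b) (testLabel b s)) =
      ((if f then 0 else testProb b : ℝ) : ℂ) := by
  rw [rspVQubit_test, expectation, map_smul, Matrix.trace_smul, smul_eq_mul, ← expectation,
    expectation_testVec]
  cases s <;> cases f <;> simp

/-- Only eight explicit tests enter, which is why the same bound serves unbounded and
polynomial-size distinguishers. -/
theorem inv_forty_le_of_tests {N ℓ : ℕ} {A : Client RSPV N ℓ} {B : Server RSPV N ℓ}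
    {σ : Simulator RSPV N ℓ} {ε : ℝ}
    (hA : ∀ b s f, (outputTest (testBasis b) (testLabel b s)
      (isUnitVec_testVec b (s ^^ f))).advantage A B ≤ ε)
    (hσ : ∀ b s f, (channelTest B (testBasis b) (testLabel b s)
      (isUnitVec_testVec b (s ^^ f))).advantage A σ ≤ ε) :
    1 / 40 ≤ ε := by
  choose F hF hw using fun t => σ.exists_weight_eq t
  let q : Transcript N ℓ → Bool → Bool → ℝ := fun t b s =>
    (expectation (testVec b s) (B.output t .qubit)).re
  let w : Transcript N ℓ → Bool → Bool → ℝ := fun t b s => (F t (proj (testVec b s))).re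
  have hFim : ∀ t b s, F t (proj (testVec b s)) = ((w t b s : ℝ) : ℂ) := fun t b s =>
    Complex.ext rfl (Complex.le_def.1 (hF t _ (proj_posSemidef _))).2.symm
  have hqim : ∀ t b s, expectation (testVec b s) (B.output t .qubit) = ((q t b s : ℝ) : ℂ) :=
    fun t b s => Complex.ext rfl
      (Complex.le_def.1 (expectation_nonneg _ (B.output_posSemidef t .qubit))).2.symm
  have hsim : ∀ b s f, (channelTest B (testBasis b) (testLabel b s)
      (isUnitVec_testVec b (s ^^ f))).accept σ.weight =
        testProb b * ∑ t, q t b (s ^^ f) * w t b s := by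
    intro b s f
    rw [accept_channelTest, Finset.mul_sum, Complex.re_sum]
    refine Finset.sum_congr rfl fun t _ => ?_
    rw [hw t _ _ (testLabel_ne_err b s), rspVQubit_test, map_smul, hFim, hqim, smul_eq_mul,
      ← Complex.ofReal_mul, ← Complex.ofReal_mul, Complex.ofReal_re]
    ring
  have hideal : ∀ b s f, (outputTest (testBasis b) (testLabel b s)
      (isUnitVec_testVec b (s ^^ f))).accept RSPV.filtered = if f then 0 else testProb b := by
    intro b s f
    rw [accept_outputTest]
    exact (congrArg Complex.re (expectation_rspVQubit b s f)).trans (Complex.ofReal_re _)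
  -- Triangle inequality through the honest protocol: one ε from security, one from availability.
  have hbound : ∀ b s f, |testProb b * ∑ t, q t b (s ^^ f) * w t b s -
      if f then 0 else testProb b| ≤ 2 * ε := by
    intro b s f
    have h1 := hA b s f
    have h2 := hσ b s f
    rw [OutputDistinguisher.advantage, hideal] at h1
    rw [ChannelDistinguisher.advantage, hsim, accept_honestRun] at h2
    rw [abs_le] at h1 h2 ⊢
    constructor <;> linarith [h1.1, h1.2, h2.1, h2.2]
  have hmp : ∑ b : Bool, ∑ s : Bool, ∑ t, q t b s * w t b s ≤
      3 * ∑ b : Bool, ∑ s : Bool, ∑ t, q t b (!s) * w t b s := by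
    have h : ∀ t, ∑ b : Bool, ∑ s : Bool, q t b s * w t b s ≤
        3 * ∑ b : Bool, ∑ s : Bool, q t b (!s) * w t b s := by
      intro t
      -- The "prepare" half: the server's output for this transcript, as a functional on test
      -- projectors.
      let G : Op 1 →ₗ[ℂ] ℂ := Matrix.traceLinearMap _ ℂ ℂ ∘ₗ
        LinearMap.mulLeft ℂ (B.output t .qubit : Op 1)
      have hG : ∀ v, G (proj v) = expectation v (B.output t .qubit) := fun v =>
        (expectation_eq_trace v _).symm
      have := measure_and_prepare_le (F t) G (fun v => hF t _ (proj_posSemidef v))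
        fun v => (hG v) ▸ expectation_nonneg v (B.output_posSemidef t .qubit)
      simpa only [hG] using this
    have hs := Finset.sum_le_sum fun t (_ : t ∈ Finset.univ) => h t
    rw [← Finset.mul_sum] at hs
    simpa only [Fintype.sum_bool, Finset.sum_add_distrib] using hs
  simp only [Fintype.sum_bool, Bool.not_true, Bool.not_false] at hmp
  -- Dividing by the probabilities 1/2, 1/2, 1/8, 1/8, the errors add up to 2ε(2 + 2 + 8 + 8) = 40ε.
  -- The correct tests then total at least 4 - 40ε and the wrong ones at most 40ε, so 4 - 40ε ≤
  -- 120ε.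
  have g1 := (abs_le.1 (hbound false false false)).1
  have g2 := (abs_le.1 (hbound false true false)).1
  have g3 := (abs_le.1 (hbound true false false)).1
  have g4 := (abs_le.1 (hbound true true false)).1
  have r1 := (abs_le.1 (hbound false false true)).2
  have r2 := (abs_le.1 (hbound false true true)).2
  have r3 := (abs_le.1 (hbound true false true)).2
  have r4 := (abs_le.1 (hbound true true true)).2
  simp only [testProb, Bool.xor_false, Bool.xor_true, Bool.not_true, Bool.not_false, if_true,
    Bool.false_eq_true, if_false] at g1 g2 g3 g4 r1 r2 r3 r4
  linarith

/-! ### Conclusion for unbounded and for polynomial-size distinguishers -/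

theorem not_classicallyRealizable {ε : ℝ} (hε : ε < 1 / 40) : ¬ ClassicallyRealizable RSPV ε := by
  rintro ⟨N, ℓ, A, B, hA, σ, hσ⟩
  exact absurd (inv_forty_le_of_tests (fun _ _ _ => hA _) fun _ _ _ => hσ _) (not_le.2 hε)

theorem PolyBounded.const (k : ℕ) : PolyBounded fun _ => k :=
  ⟨Polynomial.C k, fun n => by simp⟩

theorem PolyBounded.add_const {s : ℕ → ℕ} (hs : PolyBounded s) (k : ℕ) :
    PolyBounded fun n => s n + k := by
  obtain ⟨p, hp⟩ := hs
  exact ⟨p + Polynomial.C k, fun n => by simpa using hp n⟩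

/-- Each test is a polynomial-size family, so its advantage is eventually at most `ε n`. As there
are finitely many tests, the bounds hold simultaneously for all large `n`, in particular for one
with `ε n < 1 / 40`. -/
theorem not_computationallyClassicallyRealizable {ε : ℕ → ℝ}
    (hε : ∃ᶠ n in atTop, ε n < 1 / 40) : ¬ ComputationallyClassicallyRealizable RSPV ε := by
  rintro ⟨N, ℓ, A, B, ⟨s, hs, hB⟩, hA, σ, hσ⟩
  have h1 : ∀ᶠ n in atTop, ∀ b s f, (outputTest (testBasis b) (testLabel b s)
      (isUnitVec_testVec b (s ^^ f))).advantage (A n) (B n) ≤ ε n := by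
    simp only [eventually_all]
    intro b s f
    exact hA (fun _ => outputTest _ _ _) ⟨_, PolyBounded.const _, fun _ => outputTest_hasSize _ _ _⟩
  have h2 : ∀ᶠ n in atTop, ∀ b s f, (channelTest (B n) (testBasis b) (testLabel b s)
      (isUnitVec_testVec b (s ^^ f))).advantage (A n) (σ n) ≤ ε n := by
    simp only [eventually_all]
    intro b s' f
    exact hσ (fun n => channelTest (B n) _ _ _)
      ⟨_, hs.add_const _, fun n => channelTest_hasSize (hB n) _ _ _⟩
  obtain ⟨n, hn, hn1, hn2⟩ := (hε.and_eventually (h1.and h2)).exists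
  exact absurd (inv_forty_le_of_tests hn1 hn2) (not_le.2 hn)

end RemoteState
end

theorem mainTheorem6 :
    ∃ η : ℝ, 0 < η ∧
      (∀ ε : ℝ, 0 ≤ ε → ε < η →
        ¬ RemoteState.ClassicallyRealizable RemoteState.RSPV ε) ∧
      (∀ ε : ℕ → ℝ, (∀ n, 0 ≤ ε n) → (∃ᶠ n in Filter.atTop, ε n < η) →
        ¬ RemoteState.ComputationallyClassicallyRealizable RemoteState.RSPV ε) :=
  ⟨1 / 40, by norm_num, fun _ _ h => RemoteState.not_classicallyRealizable h,
    fun _ _ h => RemoteState.not_computationallyClassicallyRealizable h⟩
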